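/- Let $\Lambda$ be a finite set with at least two elements and let $g_i\colon[0,1]\to[0,1]$ ($i\in\Lambda$) be contracting $C^{1+\varepsilon}$ maps with non-vanishing derivative. Let $X=\bigcup_{i\in\Lambda}g_i(X)$ be the non-empty compact attractor (the self-conformal set), and assume the strong separation condition $g_i(X)\cap g_j(X)=\emptyset$ for $i\neq j$. For a finite word $\mathtt{w}=w_1\cdots w_n$ put $g_{\mathtt w}=g_{w_1}\circ\cdots\circ g_{w_n}$ ($g_\varnothing=\mathrm{id}$) and $\|g_{\mathtt w}'\|=\max_{x\in X}|g_{\mathtt w}'(x)|$. For $\mathtt i\in\Sigma=\Lambda^{\mathbb N}$ let $\mathtt i|_n$ be the word of its first $n$ symbols, let $\pi(\mathtt i)=\lim_{n\to\infty}g_{\mathtt i|_n}(0)$, and for $x\in X$ let $\mathtt i_x=\pi^{-1}(x)$. Let $\delta>0$ be such that $\operatorname{dist}(g_{\mathtt u}(X),g_{\mathtt v}(X))\ge\delta\operatorname{diam}(g_{\mathtt u}(X))$ for all $n$ and all distinct $\mathtt u,\mathtt v\in\Lambda^n$. Let $s$ be the zero of the pressure function $P(t)=\lim_{n\to\infty}\frac1n\log\sum_{\mathtt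 w\in\Lambda^n}\|g_{\mathtt w}'\|^t$, and let $\mu$ be the $s$-conformal measure on $X$, that is, the Borel probability measure supported on $X$ with $\mu(B)=\sum_{i\in\Lambda}\int_{g_i^{-1}(B)}|g_i'(x)|^s\,d\mu(x)$ for all Borel sets $B$. Let $\underline r=(r_n)_{n\ge1}$ be a non-increasing sequence of positive numbers tending to $0$. Write $B(x,\rho)$ for the open interval $(x-\rho,x+\rho)$. For $\mathtt i\in\Sigma$ and $k\ge1$ let $N(\underline r,\mathtt i,k)=\{n\ge1:\delta\operatorname{diam}(g_{\mathtt i|_k}(X))\le r_n<\operatorname{diam}(g_{\mathtt i|_{k-1}}(X))\}$, let $\underline n(\underline r,\mathtt i,k)$ be the first $n\ge1$ with $r_n<\operatorname{diam}(g_{\mathtt i|_{k-1}}(X))$, and let $\overline n(\underline r,\mathtt i,k)$ be the first $n\ge1$ with $r_n<\delta\operatorname{diam}(g_{\mathtt i|_k}(X))$. Assume that there are finite constants $C_1,C_2$ such that for all $\mathtt i\in\Sigma$ and $k\ge1$ $$\sum_{n\in N(\underline r,\mathtt i,k)}\mu(B(\pi(\mathtt i),r_n))\le C_1\qquad\text{and}\qquad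 \underline n(\underline r,\mathtt i,k)\,\|g_{\mathtt i|_{k-1}}'\|^s\le C_2 .$$ Let $$\operatorname{cap}_{\mu,\underline r}(X)=\sup_\nu\left(\iint\exp\Big(\sum_{n=1}^\infty\mu(B(x,r_n)\cap B(y,r_n))\Big)\,d\nu(y)\,d\nu(x)\right)^{-1},$$ where the supremum is over all Borel probability measures $\nu$ with compact support contained in $X$, and $\infty^{-1}=0$. Then $\operatorname{cap}_{\mu,\underline r}(X)>0$ if and only if there is a non-atomic Borel probability measure $\nu$ with support contained in $X$ such that $$\sum_{k=1}^\infty\nu(A_k(x))\exp\Big(\sum_{n=1}^{\overline n(\underline r,\mathtt i_x,k)}\mu(B(x,r_n))\Big)<\infty\qquad\text{for }\nu\text{-almost every }x,$$ where $A_k(x)=g_{\mathtt i_x|_k}(X)\setminus g_{\mathtt i_x|_{k+1}}(X)$. -/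

import Mathlib

open MeasureTheory Set Filter Topology
open scoped NNReal ENNReal

namespace DvoretzkyCovering

noncomputable section

/- ### Energy and capacity

Sequences of radii `r : ℕ → ℝ` are indexed by `n = 1, 2, …`; the value `r 0` is never used. -/

/-- The `(μ, r)`-energy `∬ exp (∑_{n ≥ 1} μ (B(x, r_n) ∩ B(y, r_n))) dν(y) dν(x)`, with values in
`[0, ∞]`. Here `EReal.exp` is the exponential function with `exp ∞ = ∞`. -/
def energy (μ : Measure ℝ) (r : ℕ → ℝ) (ν : Measure ℝ) : ℝ≥0∞ :=
  ∫⁻ x, ∫⁻ y, EReal.exp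
    ((∑' n : ℕ+, μ (Metric.ball x (r n) ∩ Metric.ball y (r n)) : ℝ≥0∞) : EReal) ∂ν ∂ν

/-- The `(μ, r)`-capacity of `A`: the supremum of `I(ν)⁻¹` over all Borel probability measures `ν`
with compact support contained in `A`, with `∞⁻¹ = 0 = sup ∅`. -/
def capacity (μ : Measure ℝ) (r : ℕ → ℝ) (A : Set ℝ) : ℝ≥0∞ :=
  ⨆ (ν : Measure ℝ) (_ : IsProbabilityMeasure ν) (_ : ν.support ⊆ A)
    (_ : IsCompact ν.support), (energy μ r ν)⁻¹

/- ### Self-conformal iterated function systems on `[0, 1]` -/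

variable {Λ : Type*}

/-- The maps `g i` restrict to contracting `C^{1+ε}` self-maps of `[0, 1]` with non-vanishing
derivative (one-sided at the end points). Values of `g i` outside `[0, 1]` are irrelevant. -/
structure IsSelfConformalIFS (g : Λ → ℝ → ℝ) : Prop where
  mapsTo : ∀ i, MapsTo (g i) (Icc 0 1) (Icc 0 1)
  contracting : ∀ i, ∃ K : ℝ≥0, K < 1 ∧ LipschitzOnWith K (g i) (Icc 0 1)
  differentiableOn : ∀ i, DifferentiableOn ℝ (g i) (Icc 0 1)
  holder_deriv : ∀ i, ∃ C ε : ℝ≥0, 0 < ε ∧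
    HolderOnWith C ε (derivWithin (g i) (Icc 0 1)) (Icc 0 1)
  deriv_ne_zero : ∀ i, ∀ x ∈ Icc (0 : ℝ) 1, derivWithin (g i) (Icc 0 1) x ≠ 0

/-- `X` is the attractor of the system: the (unique) non-empty compact subset of `[0, 1]` with
`X = ⋃ i, g i (X)`. -/
structure IsAttractor (g : Λ → ℝ → ℝ) (X : Set ℝ) : Prop where
  subset : X ⊆ Icc 0 1
  nonempty : X.Nonempty
  isCompact : IsCompact X
  eq_iUnion : X = ⋃ i, g i '' X

/-- The strong separation condition. -/
def StrongSeparation (g : Λ → ℝ → ℝ) (X : Set ℝ) : Prop :=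
  ∀ i j, i ≠ j → Disjoint (g i '' X) (g j '' X)

/-- `g_w = g_{w₁} ∘ ⋯ ∘ g_{wₙ}` for a finite word `w`; the identity for the empty word. -/
def wordMap (g : Λ → ℝ → ℝ) : List Λ → ℝ → ℝ
  | [] => id
  | i :: w => g i ∘ wordMap g w

/-- The restriction `𝐢|_n` of an infinite word to its first `n` symbols. -/
def prefixWord (i : ℕ → Λ) (n : ℕ) : List Λ :=
  List.ofFn fun j : Fin n => i j

/-- The cylinder `g_w (X)`. -/
def ifsCylinder (g : Λ → ℝ → ℝ) (X : Set ℝ) (w : List Λ) : Set ℝ :=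
  wordMap g w '' X

/-- `‖g_w'‖ = max_{x ∈ X} |g_w'(x)|`. -/
def derivNorm (g : Λ → ℝ → ℝ) (X : Set ℝ) (w : List Λ) : ℝ :=
  sSup ((fun x => |derivWithin (wordMap g w) (Icc 0 1) x|) '' X)

/-- The natural projection `π(𝐢) = lim_n g_{𝐢|_n} (0)`. -/
def coding (g : Λ → ℝ → ℝ) (i : ℕ → Λ) : ℝ :=
  limUnder atTop fun n => wordMap g (prefixWord i n) 0

/-- The address `𝐢_x = π⁻¹(x)` of a point `x` of the attractor. Under strong separation `π` is a
bijection from the infinite words onto the attractor. -/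
def address [Nonempty Λ] (g : Λ → ℝ → ℝ) (x : ℝ) : ℕ → Λ :=
  Function.invFun (coding g) x

/-- The scale `k` symbolic annulus `A_k(x) = g_{𝐢_x|_k}(X) \ g_{𝐢_x|_{k+1}}(X)`. -/
def annulus [Nonempty Λ] (g : Λ → ℝ → ℝ) (X : Set ℝ) (k : ℕ) (x : ℝ) : Set ℝ :=
  ifsCylinder g X (prefixWord (address g x) k) \ ifsCylinder g X (prefixWord (address g x) (k + 1))

/-- `δ` is a separation constant: `dist (g_u(X), g_v(X)) ≥ δ diam (g_u(X))` for all distinct words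
`u`, `v` of the same length. -/
def IsSeparationConstant (g : Λ → ℝ → ℝ) (X : Set ℝ) (δ : ℝ) : Prop :=
  0 < δ ∧ ∀ (n : ℕ) (u v : Fin n → Λ), u ≠ v →
    ∀ x ∈ ifsCylinder g X (List.ofFn u), ∀ y ∈ ifsCylinder g X (List.ofFn v),
      δ * Metric.diam (ifsCylinder g X (List.ofFn u)) ≤ dist x y

/-- The pressure function takes the value `p` at `t`:
`lim_n (1 / n) log ∑_{w ∈ Λⁿ} ‖g_w'‖ ^ t = p`. -/
def HasPressure [Fintype Λ] (g : Λ → ℝ → ℝ) (X : Set ℝ) (t p : ℝ) : Prop :=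
  Tendsto (fun n : ℕ =>
    (1 / (n : ℝ)) * Real.log (∑ w : Fin n → Λ, derivNorm g X (List.ofFn w) ^ t)) atTop (𝓝 p)

/-- `μ` is the `s`-conformal measure on `X`, where `s` is the zero of the pressure function: the
(unique) Borel probability measure supported on `X` with
`μ(B) = ∑ i, ∫_{g_i⁻¹(B)} |g_i'(x)| ^ s dμ(x)` for all Borel sets `B`. -/
structure IsConformalMeasure [Fintype Λ] (g : Λ → ℝ → ℝ) (X : Set ℝ) (s : ℝ) (μ : Measure ℝ) :
    Prop where
  pressure_eq_zero : HasPressure g X s 0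
  isProbabilityMeasure : IsProbabilityMeasure μ
  support_subset : μ.support ⊆ X
  conformal : ∀ B : Set ℝ, MeasurableSet B →
    μ B = ∑ i, ∫⁻ x in Icc 0 1 ∩ g i ⁻¹' B,
      ENNReal.ofReal (|derivWithin (g i) (Icc 0 1) x| ^ s) ∂μ

/- ### The conditions on the radii -/

/-- The first index `n ≥ 1` with `r_n < ρ`. -/
def firstIndex (r : ℕ → ℝ) (ρ : ℝ) : ℕ :=
  sInf {n | 1 ≤ n ∧ r n < ρ}

/-- `N(r, 𝐢, k)`, the indices `n ≥ 1` with
`δ diam g_{𝐢|_k}(X) ≤ r_n < diam g_{𝐢|_{k-1}}(X)`; used for `k ≥ 1` only. -/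
def scaleIndices (g : Λ → ℝ → ℝ) (X : Set ℝ) (δ : ℝ) (r : ℕ → ℝ) (i : ℕ → Λ) (k : ℕ) : Set ℕ :=
  {n | 1 ≤ n ∧ δ * Metric.diam (ifsCylinder g X (prefixWord i k)) ≤ r n ∧
    r n < Metric.diam (ifsCylinder g X (prefixWord i (k - 1)))}

/-- The lower index: the first `n ≥ 1` with `r_n < diam g_{𝐢|_{k-1}}(X)`; used for `k ≥ 1` only. -/
def lowerIndex (g : Λ → ℝ → ℝ) (X : Set ℝ) (r : ℕ → ℝ) (i : ℕ → Λ) (k : ℕ) : ℕ :=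
  firstIndex r (Metric.diam (ifsCylinder g X (prefixWord i (k - 1))))

/-- The upper index: the first `n ≥ 1` with `r_n < δ diam g_{𝐢|_k}(X)`. -/
def upperIndex (g : Λ → ℝ → ℝ) (X : Set ℝ) (δ : ℝ) (r : ℕ → ℝ) (i : ℕ → Λ) (k : ℕ) : ℕ :=
  firstIndex r (δ * Metric.diam (ifsCylinder g X (prefixWord i k)))

/-- Bounded cylinder sums:
`∑_{n ∈ N(r, 𝐢, k)} μ (B(π(𝐢), r_n)) ≤ C` for all infinite words `𝐢` and all `k ≥ 1`. -/
def BoundedCylinderSums (g : Λ → ℝ → ℝ) (X : Set ℝ) (δ : ℝ) (μ : Measure ℝ) (r : ℕ → ℝ) : Prop :=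
  ∃ C : ℝ≥0, ∀ (i : ℕ → Λ) (k : ℕ), 1 ≤ k →
    ∑' n : scaleIndices g X δ r i k, μ (Metric.ball (coding g i) (r n)) ≤ (C : ℝ≥0∞)

/-- Bounded products: the lower index times `‖g_{𝐢|_{k-1}}'‖ ^ s` is at most `C`, for all infinite
words `𝐢` and all `k ≥ 1`. -/
def BoundedProducts (g : Λ → ℝ → ℝ) (X : Set ℝ) (s : ℝ) (r : ℕ → ℝ) : Prop :=
  ∃ C : ℝ, ∀ (i : ℕ → Λ) (k : ℕ), 1 ≤ k →
    (lowerIndex g X r i k : ℝ) * derivNorm g X (prefixWord i (k - 1)) ^ s ≤ C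

end

end DvoretzkyCovering

open DvoretzkyCovering

/-! Fix `x ∈ X`, let `d_k` be the diameter of its `k`-th cylinder and `N_k` the upper index at level
`k`. The proof rests on one comparison: for `k ≥ 1` and `y` in the annulus `A_k(x)`, the overlap sum
`∑ n, μ(B(x, r_n) ∩ B(y, r_n))` equals `∑_{n ≤ N_k} μ(B(x, r_n))` up to a bounded error.
Exponentiating turns the error into a bounded factor, so splitting the potential of `ν` at `x` over
the annuli produces the series of the theorem.

Upper estimate (`exists_overlapSum_le`): separation gives `dist x y ≥ δ d_{k+1}`, so the balls are
disjoint once `r_n` is at most half of that. The indices after `N_k` whose balls still meet lie in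
boundedly many scales, and each scale costs at most the constant of the cylinder sums plus that of
the products. Lower estimate (`exists_sum_le_overlapSum`): while `r_n ≥ d_k`, the part of `B(x,
r_n)` outside `B(y, r_n)` lies in a ball of radius `d_k`. By Ahlfors regularity its mass is `O(‖g'‖
^ s)`, and the bounded products control the number of such `n`. The remaining `n` cost one cylinder
sum and a single term.

Positive capacity yields a measure with almost everywhere finite potential; conversely, such a
measure conditioned on a sublevel set of its potential has finite energy. Atoms remain. If `∑ n,
μ(B(x, r_n))` diverges at every point of `X`, an atom would carry infinite potential. If it
converges at one point, Ahlfors regularity bounds these sums uniformly, and `μ` itself is the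
required non-atomic measure. -/

namespace DvoretzkyCovering

/-! ### Word maps: chain rule, contraction and bounded distortion. -/

section Words

variable {Λ : Type*} {g : Λ → ℝ → ℝ}

theorem wordMap_append (g : Λ → ℝ → ℝ) (u v : List Λ) :
    wordMap g (u ++ v) = wordMap g u ∘ wordMap g v := by
  induction u with
  | nil => rfl
  | cons i u ih => simp only [List.cons_append, wordMap, ih, Function.comp_assoc]

theorem IsSelfConformalIFS.mapsTo_wordMap (hg : IsSelfConformalIFS g) (w : List Λ) :
    MapsTo (wordMap g w) (Icc 0 1) (Icc 0 1) := by
  induction w with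
  | nil => exact mapsTo_id _
  | cons i w ih => exact (hg.mapsTo i).comp ih

theorem IsSelfConformalIFS.differentiableOn_wordMap (hg : IsSelfConformalIFS g) (w : List Λ) :
    DifferentiableOn ℝ (wordMap g w) (Icc 0 1) := by
  induction w with
  | nil => exact differentiableOn_id
  | cons i w ih => exact (hg.differentiableOn i).comp ih (hg.mapsTo_wordMap w)

theorem IsSelfConformalIFS.continuousOn_wordMap (hg : IsSelfConformalIFS g) (w : List Λ) :
    ContinuousOn (wordMap g w) (Icc 0 1) :=
  (hg.differentiableOn_wordMap w).continuousOn

theorem IsSelfConformalIFS.derivWithin_wordMap_cons (hg : IsSelfConformalIFS g) (i : Λ)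
    (w : List Λ) {x : ℝ} (hx : x ∈ Icc (0 : ℝ) 1) :
    derivWithin (wordMap g (i :: w)) (Icc 0 1) x =
      derivWithin (g i) (Icc 0 1) (wordMap g w x) * derivWithin (wordMap g w) (Icc 0 1) x :=
  derivWithin_comp x (hg.differentiableOn i _ (hg.mapsTo_wordMap w hx))
    (hg.differentiableOn_wordMap w x hx) (hg.mapsTo_wordMap w)

theorem IsSelfConformalIFS.derivWithin_wordMap_append (hg : IsSelfConformalIFS g)
    (u v : List Λ) {x : ℝ} (hx : x ∈ Icc (0 : ℝ) 1) :
    derivWithin (wordMap g (u ++ v)) (Icc 0 1) x =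
      derivWithin (wordMap g u) (Icc 0 1) (wordMap g v x) *
        derivWithin (wordMap g v) (Icc 0 1) x := by
  rw [wordMap_append]
  exact derivWithin_comp x (hg.differentiableOn_wordMap u _ (hg.mapsTo_wordMap v hx))
    (hg.differentiableOn_wordMap v x hx) (hg.mapsTo_wordMap v)

theorem derivWithin_wordMap_nil {x : ℝ} (hx : x ∈ Icc (0 : ℝ) 1) :
    derivWithin (wordMap g []) (Icc 0 1) x = 1 :=
  derivWithin_id x _ (uniqueDiffOn_Icc zero_lt_one x hx)

theorem IsSelfConformalIFS.derivWithin_wordMap_ne_zero (hg : IsSelfConformalIFS g) (w : List Λ)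
    {x : ℝ} (hx : x ∈ Icc (0 : ℝ) 1) : derivWithin (wordMap g w) (Icc 0 1) x ≠ 0 := by
  induction w with
  | nil => rw [derivWithin_wordMap_nil hx]; exact one_ne_zero
  | cons i w ih =>
    rw [hg.derivWithin_wordMap_cons i w hx]
    exact mul_ne_zero (hg.deriv_ne_zero i _ (hg.mapsTo_wordMap w hx)) ih

theorem IsSelfConformalIFS.continuousOn_derivWithin (hg : IsSelfConformalIFS g) (i : Λ) :
    ContinuousOn (derivWithin (g i) (Icc 0 1)) (Icc 0 1) := by
  obtain ⟨C, ε, hε, h⟩ := hg.holder_deriv i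
  exact h.continuousOn hε

theorem IsSelfConformalIFS.continuousOn_derivWithin_wordMap (hg : IsSelfConformalIFS g)
    (w : List Λ) : ContinuousOn (derivWithin (wordMap g w) (Icc 0 1)) (Icc 0 1) := by
  induction w with
  | nil => exact continuousOn_const.congr fun x hx => derivWithin_wordMap_nil hx
  | cons i w ih =>
    exact (((hg.continuousOn_derivWithin i).comp (hg.continuousOn_wordMap w)
      (hg.mapsTo_wordMap w)).mul ih).congr fun x hx => hg.derivWithin_wordMap_cons i w hx

/-- Mean value theorem: in the open interval between `x` and `y` the derivative within `[0, 1]` is a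
genuine derivative, so values of `f` outside `[0, 1]` play no role. -/
theorem exists_abs_sub_eq_abs_derivWithin_mul {f : ℝ → ℝ} (hf : DifferentiableOn ℝ f (Icc 0 1))
    {x y : ℝ} (hx : x ∈ Icc (0 : ℝ) 1) (hy : y ∈ Icc (0 : ℝ) 1) :
    ∃ c ∈ Icc (0 : ℝ) 1, |f x - f y| = |derivWithin f (Icc 0 1) c| * |x - y| := by
  wlog hxy : x < y generalizing x y
  · rcases (not_lt.1 hxy).eq_or_lt with rfl | h
    · exact ⟨y, hy, by simp⟩
    · obtain ⟨c, hc, h⟩ := this hy hx h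
      exact ⟨c, hc, by rw [abs_sub_comm, h, abs_sub_comm x y]⟩
  have hsub : Icc x y ⊆ Icc 0 1 := Icc_subset_Icc hx.1 hy.2
  obtain ⟨c, hc, h⟩ := exists_hasDerivAt_eq_slope f (derivWithin f (Icc 0 1)) hxy
    (hf.continuousOn.mono hsub) fun z hz => by
      have hz' : Icc (0 : ℝ) 1 ∈ 𝓝 z := Icc_mem_nhds (hx.1.trans_lt hz.1) (hz.2.trans_le hy.2)
      exact (hf z (mem_of_mem_nhds hz')).hasDerivWithinAt.hasDerivAt hz'
  refine ⟨c, hsub (Ioo_subset_Icc_self hc), ?_⟩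
  rw [h, abs_div, abs_sub_comm x y, div_mul_cancel₀ _ (abs_pos.2 (sub_pos.2 hxy).ne').ne',
    abs_sub_comm]

theorem IsSelfConformalIFS.injOn_wordMap (hg : IsSelfConformalIFS g) (w : List Λ) :
    InjOn (wordMap g w) (Icc 0 1) := by
  intro x hx y hy hxy
  obtain ⟨c, hc, h⟩ := exists_abs_sub_eq_abs_derivWithin_mul (hg.differentiableOn_wordMap w) hx hy
  rw [hxy, sub_self, abs_zero, eq_comm, mul_eq_zero, abs_eq_zero, abs_eq_zero] at h
  exact sub_eq_zero.1 (h.resolve_left (hg.derivWithin_wordMap_ne_zero w hc))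

theorem IsSelfConformalIFS.exists_contraction [Finite Λ] (hg : IsSelfConformalIFS g) :
    ∃ K : ℝ, 0 < K ∧ K < 1 ∧ ∀ w, ∀ x ∈ Icc (0 : ℝ) 1, ∀ y ∈ Icc (0 : ℝ) 1,
      |wordMap g w x - wordMap g w y| ≤ K ^ w.length * |x - y| := by
  choose k hk1 hk using hg.contracting
  obtain ⟨K, hK1, hK⟩ : ∃ K : ℝ, (0 < K ∧ K < 1) ∧ ∀ i, (k i : ℝ) ≤ K := by
    have : ∀ᶠ K : ℝ in 𝓝[<] 1, ∀ i, (k i : ℝ) ≤ K := by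
      rw [eventually_all]
      intro i
      filter_upwards [Ioo_mem_nhdsLT (show (k i : ℝ) < 1 from mod_cast hk1 i)] with K hK
        using hK.1.le
    obtain ⟨K, h1, h2⟩ := (this.and (Ioo_mem_nhdsLT zero_lt_one)).exists
    exact ⟨K, h2, h1⟩
  refine ⟨K, hK1.1, hK1.2, fun w => ?_⟩
  induction w with
  | nil => intro x _ y _; simp [wordMap]
  | cons i w ih =>
    intro x hx y hy
    have h := (hk i).dist_le_mul _ (hg.mapsTo_wordMap w hx) _ (hg.mapsTo_wordMap w hy)
    rw [Real.dist_eq, Real.dist_eq] at h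
    calc _ ≤ _ := h
      _ ≤ K * (K ^ w.length * |x - y|) :=
        mul_le_mul (hK i) (ih x hx y hy) (abs_nonneg _) hK1.1.le
      _ = _ := by rw [List.length_cons, pow_succ]; ring

/-- The derivative is Hölder and bounded below by some `m > 0`, so an additive error `C |x - y| ^ ε`
is a relative error `(C / m) |x - y| ^ ε`, and `1 + t ≤ exp t`. Since `|x - y| ≤ 1`, the smallest
exponent serves all letters. -/
theorem IsSelfConformalIFS.exists_distortion_single [Finite Λ] (hg : IsSelfConformalIFS g) :
    ∃ L ε : ℝ, 0 ≤ L ∧ 0 < ε ∧ ∀ i, ∀ x ∈ Icc (0 : ℝ) 1, ∀ y ∈ Icc (0 : ℝ) 1,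
      |derivWithin (g i) (Icc 0 1) x| ≤
        Real.exp (L * |x - y| ^ ε) * |derivWithin (g i) (Icc 0 1) y| := by
  have key : ∀ i, ∃ L ε : ℝ, 0 ≤ L ∧ 0 < ε ∧ ∀ x ∈ Icc (0 : ℝ) 1, ∀ y ∈ Icc (0 : ℝ) 1,
      |derivWithin (g i) (Icc 0 1) x| ≤
        Real.exp (L * |x - y| ^ ε) * |derivWithin (g i) (Icc 0 1) y| := by
    intro i
    obtain ⟨C, ε, hε, h⟩ := hg.holder_deriv i
    obtain ⟨z, hz, hmin⟩ := isCompact_Icc.exists_isMinOn (nonempty_Icc.2 zero_le_one)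
      (hg.continuousOn_derivWithin i).abs
    set m := |derivWithin (g i) (Icc 0 1) z| with hm
    have hm0 : 0 < m := abs_pos.2 (hg.deriv_ne_zero i z hz)
    refine ⟨C / m, ε, by positivity, by exact_mod_cast hε, fun x hx y hy => ?_⟩
    have h1 := h.dist_le hx hy
    rw [Real.dist_eq, Real.dist_eq] at h1
    have h2 : m ≤ |derivWithin (g i) (Icc 0 1) y| := hmin hy
    have h3 := abs_sub_abs_le_abs_sub (derivWithin (g i) (Icc 0 1) x)
      (derivWithin (g i) (Icc 0 1) y)
    have h4 := Real.add_one_le_exp (C / m * |x - y| ^ (ε : ℝ))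
    have h5 : (C : ℝ) * |x - y| ^ (ε : ℝ) ≤
        C / m * |x - y| ^ (ε : ℝ) * |derivWithin (g i) (Icc 0 1) y| := by
      calc (C : ℝ) * |x - y| ^ (ε : ℝ) = C / m * |x - y| ^ (ε : ℝ) * m := by field_simp
        _ ≤ _ := by gcongr
    nlinarith [mul_le_mul_of_nonneg_right h4 (abs_nonneg (derivWithin (g i) (Icc 0 1) y))]
  choose L ε hL hε h using key
  cases nonempty_fintype Λ
  cases isEmpty_or_nonempty Λ
  · exact ⟨0, 1, le_rfl, one_pos, fun i => isEmptyElim i⟩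
  obtain ⟨j, hj⟩ := Finite.exists_min ε
  refine ⟨∑ i, L i, ε j, Finset.sum_nonneg fun i _ => hL i, hε j, fun i x hx y hy => ?_⟩
  refine (h i x hx y hy).trans ?_
  have h1 : |x - y| ≤ 1 := abs_sub_le_iff.2 ⟨by linarith [hx.2, hy.1], by linarith [hx.1, hy.2]⟩
  have h2 : L i ≤ ∑ i, L i := Finset.single_le_sum (fun i _ => hL i) (Finset.mem_univ i)
  have h3 : |x - y| ^ ε i ≤ |x - y| ^ ε j := by
    rcases (abs_nonneg (x - y)).eq_or_lt with h0 | h0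
    · rw [← h0, Real.zero_rpow (hε i).ne', Real.zero_rpow (hε j).ne']
    · exact Real.rpow_le_rpow_of_exponent_ge h0 h1 (hj i)
  have h4 : 0 ≤ ∑ i, L i := Finset.sum_nonneg fun i _ => hL i
  gcongr

/-- Bounded distortion. -/
theorem IsSelfConformalIFS.exists_distortion [Finite Λ] (hg : IsSelfConformalIFS g) :
    ∃ D : ℝ, 1 ≤ D ∧ ∀ w, ∀ x ∈ Icc (0 : ℝ) 1, ∀ y ∈ Icc (0 : ℝ) 1,
      |derivWithin (wordMap g w) (Icc 0 1) x| ≤ D * |derivWithin (wordMap g w) (Icc 0 1) y| := by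
  obtain ⟨K, hK0, hK1, hK⟩ := hg.exists_contraction
  obtain ⟨L, ε, hL, hε, h⟩ := hg.exists_distortion_single
  have hq0 : 0 ≤ K ^ ε := by positivity
  have hq1 : K ^ ε < 1 := Real.rpow_lt_one hK0.le hK1 hε
  -- By the chain rule, prepending a letter to `w` costs one single-map factor at points at most `K
  -- ^ w.length` apart, so the exponents form a geometric series.
  have key : ∀ w, ∀ x ∈ Icc (0 : ℝ) 1, ∀ y ∈ Icc (0 : ℝ) 1,
      |derivWithin (wordMap g w) (Icc 0 1) x| ≤
        Real.exp (L * ∑ j ∈ Finset.range w.length, (K ^ ε) ^ j) *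
          |derivWithin (wordMap g w) (Icc 0 1) y| := by
    intro w
    induction w with
    | nil =>
      intro x hx y hy
      rw [derivWithin_wordMap_nil hx, derivWithin_wordMap_nil hy]
      simp
    | cons i w ih =>
      intro x hx y hy
      rw [hg.derivWithin_wordMap_cons i w hx, hg.derivWithin_wordMap_cons i w hy, abs_mul, abs_mul,
        List.length_cons, Finset.sum_range_succ, mul_add, Real.exp_add]
      have h1 := h i _ (hg.mapsTo_wordMap w hx) _ (hg.mapsTo_wordMap w hy)
      have h2 : |wordMap g w x - wordMap g w y| ^ ε ≤ (K ^ ε) ^ w.length := by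
        have h3 : |wordMap g w x - wordMap g w y| ≤ K ^ w.length := by
          refine (hK w x hx y hy).trans (mul_le_of_le_one_right (by positivity) ?_)
          exact abs_sub_le_iff.2 ⟨by linarith [hx.2, hy.1], by linarith [hx.1, hy.2]⟩
        calc _ ≤ (K ^ w.length) ^ ε := Real.rpow_le_rpow (abs_nonneg _) h3 hε.le
          _ = _ := by
            rw [← Real.rpow_natCast, ← Real.rpow_natCast, ← Real.rpow_mul hK0.le,
              ← Real.rpow_mul hK0.le, mul_comm]
      have h4 : |derivWithin (g i) (Icc 0 1) (wordMap g w x)| ≤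
          Real.exp (L * (K ^ ε) ^ w.length) *
            |derivWithin (g i) (Icc 0 1) (wordMap g w y)| := by
        refine h1.trans ?_
        gcongr
      calc _ ≤ _ := mul_le_mul h4 (ih x hx y hy) (abs_nonneg _) (by positivity)
        _ = _ := by ring
  refine ⟨Real.exp (L * (1 - K ^ ε)⁻¹), Real.one_le_exp (mul_nonneg hL
    (inv_nonneg.2 (by linarith))), fun w x hx y hy => (key w x hx y hy).trans ?_⟩
  have : ∑ j ∈ Finset.range w.length, (K ^ ε) ^ j ≤ (1 - K ^ ε)⁻¹ := by
    rw [← tsum_geometric_of_lt_one hq0 hq1]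
    exact (summable_geometric_of_lt_one hq0 hq1).sum_le_tsum _ fun _ _ => by positivity
  gcongr

theorem prefixWord_zero (i : ℕ → Λ) : prefixWord i 0 = [] := rfl

theorem prefixWord_succ (i : ℕ → Λ) (n : ℕ) : prefixWord i (n + 1) = prefixWord i n ++ [i n] := by
  simp only [prefixWord, List.ofFn_succ_last, Fin.val_last, Fin.val_castSucc]

theorem length_prefixWord (i : ℕ → Λ) (n : ℕ) : (prefixWord i n).length = n := by
  simp [prefixWord]

end Words

/-! ### Cylinders, coding and separation; diameters against derivative norms. -/

section Cylinders

variable {Λ : Type*} {g : Λ → ℝ → ℝ} {X : Set ℝ} {δ : ℝ}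

theorem IsAttractor.mapsTo_wordMap (hX : IsAttractor g X) (w : List Λ) :
    MapsTo (wordMap g w) X X := by
  induction w with
  | nil => exact mapsTo_id _
  | cons i w ih =>
    refine MapsTo.comp (fun x hx => ?_) ih
    rw [hX.eq_iUnion]
    exact mem_iUnion_of_mem i (mem_image_of_mem _ hx)

theorem IsAttractor.ifsCylinder_subset (hX : IsAttractor g X) (w : List Λ) :
    ifsCylinder g X w ⊆ X :=
  (hX.mapsTo_wordMap w).image_subset

theorem ifsCylinder_nil : ifsCylinder g X [] = X := image_id X

theorem ifsCylinder_append (u v : List Λ) :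
    ifsCylinder g X (u ++ v) = wordMap g u '' ifsCylinder g X v := by
  rw [ifsCylinder, wordMap_append, image_comp, ifsCylinder]

theorem IsAttractor.ifsCylinder_append_subset (hX : IsAttractor g X) (u v : List Λ) :
    ifsCylinder g X (u ++ v) ⊆ ifsCylinder g X u := by
  rw [ifsCylinder_append]
  exact image_mono (hX.ifsCylinder_subset v)

theorem IsAttractor.isCompact_ifsCylinder (hX : IsAttractor g X) (hg : IsSelfConformalIFS g)
    (w : List Λ) : IsCompact (ifsCylinder g X w) :=
  hX.isCompact.image_of_continuousOn ((hg.continuousOn_wordMap w).mono hX.subset)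

theorem IsAttractor.diam_le_one (hX : IsAttractor g X) : Metric.diam X ≤ 1 := by
  refine (Metric.diam_mono hX.subset (Metric.isBounded_Icc 0 1)).trans ?_
  rw [Real.diam_Icc zero_le_one, sub_zero]

theorem IsAttractor.nontrivial [Nontrivial Λ] (hX : IsAttractor g X)
    (hsep : StrongSeparation g X) : X.Nontrivial := by
  obtain ⟨i, j, hij⟩ := exists_pair_ne Λ
  obtain ⟨x, hx⟩ := hX.nonempty
  exact ⟨g i x, hX.mapsTo_wordMap [i] hx, g j x, hX.mapsTo_wordMap [j] hx,
    (hsep i j hij).ne_of_mem (mem_image_of_mem _ hx) (mem_image_of_mem _ hx)⟩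

theorem IsAttractor.diam_ifsCylinder_pos [Nontrivial Λ] (hX : IsAttractor g X)
    (hg : IsSelfConformalIFS g) (hsep : StrongSeparation g X) (w : List Λ) :
    0 < Metric.diam (ifsCylinder g X w) :=
  Metric.diam_pos ((hX.nontrivial hsep).image_of_injOn ((hg.injOn_wordMap w).mono hX.subset))
    (hX.isCompact_ifsCylinder hg w).isBounded

theorem IsAttractor.diam_ifsCylinder_prefixWord_antitone (hX : IsAttractor g X)
    (hg : IsSelfConformalIFS g) (i : ℕ → Λ) :
    Antitone fun k => Metric.diam (ifsCylinder g X (prefixWord i k)) :=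
  antitone_nat_of_succ_le fun k => Metric.diam_mono
    (by rw [prefixWord_succ]; exact hX.ifsCylinder_append_subset _ _)
    (hX.isCompact_ifsCylinder hg _).isBounded

theorem IsAttractor.ifsCylinder_prefixWord_antitone (hX : IsAttractor g X) (i : ℕ → Λ) :
    Antitone fun k => ifsCylinder g X (prefixWord i k) :=
  antitone_nat_of_succ_le fun k => by
    rw [prefixWord_succ]; exact hX.ifsCylinder_append_subset _ _

theorem IsAttractor.tendsto_diam_ifsCylinder [Finite Λ] (hX : IsAttractor g X)
    (hg : IsSelfConformalIFS g) (i : ℕ → Λ) :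
    Tendsto (fun k => Metric.diam (ifsCylinder g X (prefixWord i k))) atTop (𝓝 0) := by
  obtain ⟨K, hK0, hK1, hK⟩ := hg.exists_contraction
  refine squeeze_zero (fun _ => Metric.diam_nonneg) (fun k => ?_)
    (tendsto_pow_atTop_nhds_zero_of_lt_one hK0.le hK1)
  refine Metric.diam_le_of_forall_dist_le (by positivity) ?_
  rintro _ ⟨x, hx, rfl⟩ _ ⟨y, hy, rfl⟩
  replace hx := hX.subset hx
  replace hy := hX.subset hy
  have h := hK (prefixWord i k) x hx y hy
  rw [length_prefixWord] at h
  exact h.trans (mul_le_of_le_one_right (by positivity)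
    (abs_sub_le_iff.2 ⟨by linarith [hx.2, hy.1], by linarith [hx.1, hy.2]⟩))

/-! ### The coding map -/

/-- The base point `0` need not lie in `X`, but its image under the `n`-th prefix is within `K ^ n`
of every point of the `n`-th cylinder. -/
theorem IsAttractor.coding_eq [Finite Λ] (hX : IsAttractor g X) (hg : IsSelfConformalIFS g)
    {i : ℕ → Λ} {x : ℝ} (hx : ∀ n, x ∈ ifsCylinder g X (prefixWord i n)) : coding g i = x := by
  obtain ⟨K, hK0, hK1, hK⟩ := hg.exists_contraction
  refine Tendsto.limUnder_eq ?_
  rw [tendsto_iff_dist_tendsto_zero]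
  refine squeeze_zero (fun _ => dist_nonneg) (fun n => ?_)
    (tendsto_pow_atTop_nhds_zero_of_lt_one hK0.le hK1)
  obtain ⟨y, hy, hxy⟩ := hx n
  replace hy := hX.subset hy
  have h := hK (prefixWord i n) 0 (left_mem_Icc.2 zero_le_one) y hy
  rw [length_prefixWord, hxy] at h
  refine h.trans (mul_le_of_le_one_right (by positivity) ?_)
  rw [zero_sub, abs_neg, abs_of_nonneg hy.1]
  exact hy.2

theorem IsAttractor.coding_mem_ifsCylinder [Finite Λ] (hX : IsAttractor g X)
    (hg : IsSelfConformalIFS g) (i : ℕ → Λ) (n : ℕ) :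
    coding g i ∈ ifsCylinder g X (prefixWord i n) := by
  obtain ⟨x, hx⟩ := IsCompact.nonempty_iInter_of_sequence_nonempty_isCompact_isClosed
    (fun n => ifsCylinder g X (prefixWord i n))
    (fun n => hX.ifsCylinder_prefixWord_antitone i n.le_succ)
    (fun n => hX.nonempty.image _) (hX.isCompact_ifsCylinder hg _)
    (fun n => (hX.isCompact_ifsCylinder hg _).isClosed)
  rw [mem_iInter] at hx
  rw [hX.coding_eq hg hx]
  exact hx n

/-- Choose for each point of `X` a letter and a preimage in `X`; iterating the preimage map reads
off an address. -/
theorem IsAttractor.exists_coding_eq [Finite Λ] (hX : IsAttractor g X)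
    (hg : IsSelfConformalIFS g) {x : ℝ} (hx : x ∈ X) : ∃ i, coding g i = x := by
  have h : ∀ x : X, ∃ a, ∃ y : X, g a y = x := by
    rintro ⟨x, hx⟩
    rw [hX.eq_iUnion, mem_iUnion] at hx
    obtain ⟨a, y, hy, h⟩ := hx
    exact ⟨a, ⟨y, hy⟩, h⟩
  choose a y hay using h
  have key : ∀ n, wordMap g (prefixWord (fun n => a (y^[n] ⟨x, hx⟩)) n) (y^[n] ⟨x, hx⟩) = x := by
    intro n
    induction n with
    | zero => rfl
    | succ n ih =>
      rw [prefixWord_succ, wordMap_append, Function.comp_apply, Function.iterate_succ_apply']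
      exact (congrArg _ (hay _)).trans ih
  exact ⟨_, hX.coding_eq hg fun n => ⟨_, (y^[n] ⟨x, hx⟩).2, key n⟩⟩

theorem IsAttractor.coding_address [Finite Λ] [Nonempty Λ] (hX : IsAttractor g X)
    (hg : IsSelfConformalIFS g) {x : ℝ} (hx : x ∈ X) : coding g (address g x) = x :=
  Function.invFun_eq (hX.exists_coding_eq hg hx)

theorem IsSeparationConstant.mul_diam_le_dist (hδ : IsSeparationConstant g X δ) {i j : ℕ → Λ}
    {n : ℕ} (hij : prefixWord i n ≠ prefixWord j n) {x y : ℝ}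
    (hx : x ∈ ifsCylinder g X (prefixWord i n)) (hy : y ∈ ifsCylinder g X (prefixWord j n)) :
    δ * Metric.diam (ifsCylinder g X (prefixWord i n)) ≤ dist x y :=
  hδ.2 n _ _ (fun h => hij (congrArg List.ofFn h)) x hx y hy

/-- The form in which separation is used: a point of `X` in another cylinder of the same level would
be too far away. -/
theorem IsSeparationConstant.mem_ifsCylinder_of_dist_lt [Finite Λ] [Nonempty Λ]
    (hδ : IsSeparationConstant g X δ) (hX : IsAttractor g X) (hg : IsSelfConformalIFS g)
    {i : ℕ → Λ} {n : ℕ} {x y : ℝ} (hx : x ∈ ifsCylinder g X (prefixWord i n)) (hy : y ∈ X)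
    (h : dist x y < δ * Metric.diam (ifsCylinder g X (prefixWord i n))) :
    y ∈ ifsCylinder g X (prefixWord i n) := by
  have hy' := hX.coding_mem_ifsCylinder hg (address g y) n
  rw [hX.coding_address hg hy] at hy'
  by_contra hn
  refine absurd (hδ.mul_diam_le_dist (fun he => hn ?_) hx hy') (not_le.2 h)
  rwa [he]

/-! ### Comparison of derivatives and diameters -/

theorem IsAttractor.exists_derivNorm_eq (hX : IsAttractor g X) (hg : IsSelfConformalIFS g)
    (w : List Λ) : ∃ z ∈ X, derivNorm g X w = |derivWithin (wordMap g w) (Icc 0 1) z| :=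
  hX.isCompact.exists_sSup_image_eq hX.nonempty
    ((hg.continuousOn_derivWithin_wordMap w).abs.mono hX.subset)

theorem IsAttractor.derivNorm_pos (hX : IsAttractor g X) (hg : IsSelfConformalIFS g)
    (w : List Λ) : 0 < derivNorm g X w := by
  obtain ⟨z, hz, h⟩ := hX.exists_derivNorm_eq hg w
  rw [h]
  exact abs_pos.2 (hg.derivWithin_wordMap_ne_zero w (hX.subset hz))

theorem IsAttractor.abs_derivWithin_le_derivNorm (hX : IsAttractor g X)
    (hg : IsSelfConformalIFS g) (w : List Λ) {x : ℝ} (hx : x ∈ X) :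
    |derivWithin (wordMap g w) (Icc 0 1) x| ≤ derivNorm g X w :=
  le_csSup (hX.isCompact.bddAbove_image
    ((hg.continuousOn_derivWithin_wordMap w).abs.mono hX.subset)) (mem_image_of_mem _ hx)

theorem IsAttractor.exists_distortion [Finite Λ] (hX : IsAttractor g X)
    (hg : IsSelfConformalIFS g) : ∃ D : ℝ, 1 ≤ D ∧ ∀ w, ∀ x ∈ Icc (0 : ℝ) 1,
      |derivWithin (wordMap g w) (Icc 0 1) x| ≤ D * derivNorm g X w ∧
        derivNorm g X w ≤ D * |derivWithin (wordMap g w) (Icc 0 1) x| := by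
  obtain ⟨D, hD, h⟩ := hg.exists_distortion
  refine ⟨D, hD, fun w x hx => ?_⟩
  obtain ⟨z, hz, hz'⟩ := hX.exists_derivNorm_eq hg w
  rw [hz']
  exact ⟨h w x hx z (hX.subset hz), h w z (hX.subset hz) x hx⟩

theorem IsAttractor.exists_diam_image_comparison [Finite Λ] (hX : IsAttractor g X)
    (hg : IsSelfConformalIFS g) : ∃ D : ℝ, 1 ≤ D ∧ ∀ w, ∀ A ⊆ Icc (0 : ℝ) 1,
      Metric.diam (wordMap g w '' A) ≤ D * derivNorm g X w * Metric.diam A ∧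
        derivNorm g X w * Metric.diam A ≤ D * Metric.diam (wordMap g w '' A) := by
  obtain ⟨D, hD, h⟩ := hX.exists_distortion hg
  have hD0 : 0 < D := one_pos.trans_le hD
  refine ⟨D, hD, fun w A hA => ?_⟩
  have hb : Bornology.IsBounded A := (Metric.isBounded_Icc 0 1).subset hA
  have hb' : Bornology.IsBounded (wordMap g w '' A) :=
    (Metric.isBounded_Icc 0 1).subset ((hg.mapsTo_wordMap w).mono_left hA).image_subset
  have hN := hX.derivNorm_pos hg w
  constructor
  · refine Metric.diam_le_of_forall_dist_le
      (mul_nonneg (by positivity) Metric.diam_nonneg) ?_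
    rintro _ ⟨x, hx, rfl⟩ _ ⟨y, hy, rfl⟩
    obtain ⟨c, hc, hxy⟩ := exists_abs_sub_eq_abs_derivWithin_mul (hg.differentiableOn_wordMap w)
      (hA hx) (hA hy)
    rw [Real.dist_eq, hxy]
    exact mul_le_mul (h w c hc).1 (Metric.dist_le_diam_of_mem hb hx hy) (abs_nonneg _)
      (by positivity)
  · rw [mul_comm, ← le_div_iff₀ hN]
    refine Metric.diam_le_of_forall_dist_le
      (div_nonneg (mul_nonneg hD0.le Metric.diam_nonneg) hN.le) fun x hx y hy => ?_
    rw [le_div_iff₀ hN]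
    obtain ⟨c, hc, hxy⟩ := exists_abs_sub_eq_abs_derivWithin_mul (hg.differentiableOn_wordMap w)
      (hA hx) (hA hy)
    have h1 := Metric.dist_le_diam_of_mem hb' (mem_image_of_mem _ hx) (mem_image_of_mem _ hy)
    rw [Real.dist_eq, hxy] at h1
    calc dist x y * derivNorm g X w
        ≤ |x - y| * (D * |derivWithin (wordMap g w) (Icc 0 1) c|) :=
          mul_le_mul_of_nonneg_left (h w c hc).2 (abs_nonneg _)
      _ = D * (|derivWithin (wordMap g w) (Icc 0 1) c| * |x - y|) := by ring
      _ ≤ _ := by gcongr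

theorem IsAttractor.exists_diam_comparison [Finite Λ] [Nontrivial Λ] (hX : IsAttractor g X)
    (hg : IsSelfConformalIFS g) (hsep : StrongSeparation g X) : ∃ C : ℝ, 1 ≤ C ∧
      ∀ w, Metric.diam (ifsCylinder g X w) ≤ C * derivNorm g X w ∧
        derivNorm g X w ≤ C * Metric.diam (ifsCylinder g X w) := by
  obtain ⟨D, hD, h⟩ := hX.exists_diam_image_comparison hg
  have hd : 0 < Metric.diam X := by
    simpa only [ifsCylinder_nil] using hX.diam_ifsCylinder_pos hg hsep []
  have hd1 := hX.diam_le_one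
  refine ⟨D / Metric.diam X, (one_le_div hd).2 (hd1.trans hD), fun w => ?_⟩
  obtain ⟨h1, h2⟩ := h w X hX.subset
  have hN := hX.derivNorm_pos hg w
  have hD0 : 0 < D := one_pos.trans_le hD
  constructor
  · refine h1.trans ?_
    rw [div_mul_eq_mul_div, le_div_iff₀ hd, mul_assoc]
    exact mul_le_of_le_one_right (by positivity) (mul_le_one₀ hd1 hd.le hd1)
  · rw [div_mul_eq_mul_div, le_div_iff₀ hd]
    exact h2

/-- By bounded distortion, appending a letter `a` shrinks a cylinder by a factor comparable to the
diameter of `g a '' X`, and a finite alphabet gives these a positive minimum. -/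
theorem IsAttractor.exists_diam_le_mul_diam_succ [Finite Λ] [Nontrivial Λ]
    (hX : IsAttractor g X) (hg : IsSelfConformalIFS g) (hsep : StrongSeparation g X) :
    ∃ C : ℝ, 1 ≤ C ∧ ∀ i k, Metric.diam (ifsCylinder g X (prefixWord i k)) ≤
      C * Metric.diam (ifsCylinder g X (prefixWord i (k + 1))) := by
  obtain ⟨D, hD, h⟩ := hX.exists_diam_image_comparison hg
  have hD0 : 0 < D := one_pos.trans_le hD
  obtain ⟨a, ha⟩ := Finite.exists_min fun a : Λ => Metric.diam (ifsCylinder g X [a])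
  set c := Metric.diam (ifsCylinder g X [a]) with hc
  have hc0 : 0 < c := hX.diam_ifsCylinder_pos hg hsep [a]
  have hd1 := hX.diam_le_one
  have hc1 : c ≤ 1 :=
    (Metric.diam_mono (hX.ifsCylinder_subset _) hX.isCompact.isBounded).trans hd1
  refine ⟨D * D / c, (one_le_div hc0).2 (hc1.trans (one_le_mul_of_one_le_of_one_le hD hD)),
    fun i k => ?_⟩
  have hN := hX.derivNorm_pos hg (prefixWord i k)
  have h1 := (h (prefixWord i k) X hX.subset).1
  have h2 := (h (prefixWord i k) (ifsCylinder g X [i k])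
    ((hX.ifsCylinder_subset _).trans hX.subset)).2
  rw [← ifsCylinder_append, ← prefixWord_succ] at h2
  have h3 : derivNorm g X (prefixWord i k) * c ≤ _ :=
    (mul_le_mul_of_nonneg_left (ha (i k)) hN.le).trans h2
  rw [div_mul_eq_mul_div, le_div_iff₀ hc0]
  calc _ ≤ D * derivNorm g X (prefixWord i k) * c :=
        mul_le_mul_of_nonneg_right (h1.trans (mul_le_of_le_one_right (by positivity) hd1)) hc0.le
    _ ≤ _ := by rw [mul_assoc, mul_assoc]; exact mul_le_mul_of_nonneg_left h3 hD0.le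

/-- Appending `m` letters multiplies the diameter by at most `D * C * K ^ m`, so any `m` with `K ^ m
< (2 * D * C)⁻¹` works. -/
theorem IsAttractor.exists_diam_add_le_half [Finite Λ] [Nontrivial Λ] (hX : IsAttractor g X)
    (hg : IsSelfConformalIFS g) (hsep : StrongSeparation g X) :
    ∃ m : ℕ, ∀ i k, Metric.diam (ifsCylinder g X (prefixWord i (k + m))) ≤
      Metric.diam (ifsCylinder g X (prefixWord i k)) / 2 := by
  obtain ⟨D, hD, h⟩ := hX.exists_diam_image_comparison hg
  obtain ⟨C, hC, hCw⟩ := hX.exists_diam_comparison hg hsep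
  obtain ⟨K, hK0, hK1, hK⟩ := hg.exists_contraction
  have hD0 : 0 < D := one_pos.trans_le hD
  have hC0 : 0 < C := one_pos.trans_le hC
  obtain ⟨m, hm⟩ := exists_pow_lt_of_lt_one (show 0 < (2 * D * C)⁻¹ by positivity) hK1
  refine ⟨m, fun i k => ?_⟩
  have hN := hX.derivNorm_pos hg (prefixWord i k)
  have happ : prefixWord i (k + m) = prefixWord i k ++ prefixWord (fun n => i (k + n)) m := by
    clear hm
    induction m with
    | zero => rw [prefixWord_zero, List.append_nil, add_zero]
    | succ m ih => rw [← add_assoc, prefixWord_succ, ih, prefixWord_succ, List.append_assoc]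
  have h1 := (h (prefixWord i k) (ifsCylinder g X (prefixWord (fun n => i (k + n)) m))
    ((hX.ifsCylinder_subset _).trans hX.subset)).1
  rw [← ifsCylinder_append, ← happ] at h1
  have h2 : Metric.diam (ifsCylinder g X (prefixWord (fun n => i (k + n)) m)) ≤ K ^ m := by
    refine Metric.diam_le_of_forall_dist_le (by positivity) ?_
    rintro _ ⟨x, hx, rfl⟩ _ ⟨y, hy, rfl⟩
    replace hx := hX.subset hx
    replace hy := hX.subset hy
    have h := hK (prefixWord (fun n => i (k + n)) m) x hx y hy
    rw [length_prefixWord] at h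
    exact h.trans (mul_le_of_le_one_right (by positivity)
      (abs_sub_le_iff.2 ⟨by linarith [hx.2, hy.1], by linarith [hx.1, hy.2]⟩))
  have hdk := hX.diam_ifsCylinder_pos hg hsep (prefixWord i k)
  calc _ ≤ _ := h1
    _ ≤ D * (C * Metric.diam (ifsCylinder g X (prefixWord i k))) * (2 * D * C)⁻¹ := by
      gcongr
      · exact (hCw _).2
      · exact h2.trans hm.le
    _ = _ := by field_simp

end Cylinders

/-! ### The conformal measure and its Ahlfors regularity. -/

section ConformalMeasure

variable {Λ : Type*} [Fintype Λ] {g : Λ → ℝ → ℝ} {X : Set ℝ} {δ s : ℝ} {μ : Measure ℝ}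

/-- Derivative norms are at most `C`, so for `s ≤ 0` the `n`-th partition sum is at least `C ^ s`
times the number of words, and the pressure would be at least `log (card Λ) > 0`. -/
theorem HasPressure.pos_of_zero [Nontrivial Λ] (hs : HasPressure g X s 0)
    (hX : IsAttractor g X) (hg : IsSelfConformalIFS g) (hsep : StrongSeparation g X) : 0 < s := by
  by_contra! hs0
  obtain ⟨C, hC, hCw⟩ := hX.exists_diam_comparison hg hsep
  have hC0 : 0 < C := one_pos.trans_le hC
  have hcard : (1 : ℝ) < Fintype.card Λ := mod_cast Fintype.one_lt_card
  have hlim : Tendsto (fun n : ℕ => Real.log (Fintype.card Λ) + s * Real.log C / n) atTop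
      (𝓝 (Real.log (Fintype.card Λ) + 0)) :=
    tendsto_const_nhds.add (tendsto_const_div_atTop_nhds_zero_nat _)
  refine absurd (le_of_tendsto_of_tendsto hlim hs ?_) (not_le.2 ?_)
  · filter_upwards [eventually_gt_atTop 0] with n hn
    have hn' : (0 : ℝ) < n := mod_cast hn
    have h1 : (Fintype.card Λ : ℝ) ^ n * C ^ s ≤
        ∑ w : Fin n → Λ, derivNorm g X (List.ofFn w) ^ s := by
      calc (Fintype.card Λ : ℝ) ^ n * C ^ s = ∑ w : Fin n → Λ, C ^ s := by simp
        _ ≤ _ := Finset.sum_le_sum fun w _ =>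
          Real.rpow_le_rpow_of_nonpos (hX.derivNorm_pos hg _) ((hCw _).2.trans
            (mul_le_of_le_one_right hC0.le ((Metric.diam_mono (hX.ifsCylinder_subset _)
              hX.isCompact.isBounded).trans hX.diam_le_one))) hs0
    have h2 := Real.log_le_log (by positivity) h1
    rw [Real.log_mul (by positivity) (by positivity), Real.log_pow, Real.log_rpow hC0] at h2
    calc _ = 1 / (n : ℝ) * (n * Real.log (Fintype.card Λ) + s * Real.log C) := by field_simp
      _ ≤ _ := by gcongr
  · rw [add_zero]
    exact Real.log_pos hcard

theorem IsConformalMeasure.measure_compl (hμ : IsConformalMeasure g X s μ) : μ Xᶜ = 0 :=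
  measure_mono_null (compl_subset_compl.2 hμ.support_subset) Measure.measure_compl_support

theorem IsConformalMeasure.measure_inter_eq (hμ : IsConformalMeasure g X s μ) (A : Set ℝ) :
    μ (A ∩ X) = μ A :=
  measure_inter_conull hμ.measure_compl

theorem IsConformalMeasure.measure_attractor (hμ : IsConformalMeasure g X s μ) : μ X = 1 := by
  have := hμ.isProbabilityMeasure
  rw [← univ_inter X, hμ.measure_inter_eq, measure_univ]

/-- Strong separation leaves one term of the conformality sum: for `j ≠ i`, no point of `X` is
mapped by `g j` into `g i '' X`. -/
theorem IsConformalMeasure.measure_inter_image (hμ : IsConformalMeasure g X s μ)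
    (hX : IsAttractor g X) (hg : IsSelfConformalIFS g) (hsep : StrongSeparation g X) (i : Λ)
    {B : Set ℝ} (hB : IsCompact B) (hBX : B ⊆ X) {A : Set ℝ} (hA : MeasurableSet A) :
    μ (A ∩ g i '' B) = ∫⁻ x in g i ⁻¹' A ∩ B,
      ENNReal.ofReal (|derivWithin (g i) (Icc 0 1) x| ^ s) ∂μ := by
  have hcont : ContinuousOn (g i) (Icc 0 1) := (hg.differentiableOn i).continuousOn
  have hgB : MeasurableSet (g i '' B) :=
    (hB.image_of_continuousOn (hcont.mono (hBX.trans hX.subset))).measurableSet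
  have hsubX : ∀ {j}, g j '' X ⊆ X := fun {j} => (hX.mapsTo_wordMap [j]).image_subset
  rw [hμ.conformal _ (hA.inter hgB), Finset.sum_eq_single i]
  · congr 2
    ext x
    constructor
    · rintro ⟨hx, hxA, y, hy, hyx⟩
      have : y = x := hg.injOn_wordMap [i] (hX.subset (hBX hy)) hx hyx
      exact ⟨hxA, this ▸ hy⟩
    · exact fun hx => ⟨hX.subset (hBX hx.2), hx.1, mem_image_of_mem _ hx.2⟩
  · intro j _ hji
    refine setLIntegral_measure_zero _ _ (measure_mono_null ?_ hμ.measure_compl)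
    rintro x ⟨-, -, y, hy, hyx⟩ hxX
    exact (hsep j i hji).ne_of_mem (mem_image_of_mem _ hxX) (mem_image_of_mem _ (hBX hy)) hyx.symm
  · exact fun h => absurd (Finset.mem_univ i) h

theorem IsConformalMeasure.setLIntegral_image (hμ : IsConformalMeasure g X s μ)
    (hX : IsAttractor g X) (hg : IsSelfConformalIFS g) (hsep : StrongSeparation g X) (i : Λ)
    {B : Set ℝ} (hB : IsCompact B) (hBX : B ⊆ X) {f : ℝ → ℝ≥0∞} (hf : ContinuousOn f (Icc 0 1)) :
    ∫⁻ x in g i '' B, f x ∂μ = ∫⁻ x in B,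
      ENNReal.ofReal (|derivWithin (g i) (Icc 0 1) x| ^ s) * f (g i x) ∂μ := by
  have := hμ.isProbabilityMeasure
  have hcont : ContinuousOn (g i) (Icc 0 1) := (hg.differentiableOn i).continuousOn
  have hBI : B ⊆ Icc 0 1 := hBX.trans hX.subset
  have hgB : IsCompact (g i '' B) := hB.image_of_continuousOn (hcont.mono hBI)
  have hgBI : g i '' B ⊆ Icc 0 1 := ((hg.mapsTo i).mono_left hBI).image_subset
  have hae : AEMeasurable (g i) (μ.restrict B) := (hcont.mono hBI).aemeasurable hB.measurableSet
  set ρ : ℝ → ℝ≥0∞ := fun x => ENNReal.ofReal (|derivWithin (g i) (Icc 0 1) x| ^ s) with hρ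
  have hρm : AEMeasurable ρ (μ.restrict B) := by
    have h : AEMeasurable (derivWithin (g i) (Icc 0 1)) (μ.restrict B) :=
      ((hg.continuousOn_derivWithin i).mono hBI).aemeasurable hB.measurableSet
    have h' : Measurable fun t : ℝ => ENNReal.ofReal (|t| ^ s) := by fun_prop
    exact h'.comp_aemeasurable h
  have hae' : AEMeasurable (g i) ((μ.restrict B).withDensity ρ) :=
    hae.mono' (withDensity_absolutelyContinuous _ _)
  have key : μ.restrict (g i '' B) = ((μ.restrict B).withDensity ρ).map (g i) := by
    ext A hA
    rw [Measure.restrict_apply hA, hμ.measure_inter_image hX hg hsep i hB hBX hA,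
      Measure.map_apply_of_aemeasurable hae' hA, withDensity_apply',
      Measure.restrict_restrict' hB.measurableSet]
  have hfm : AEMeasurable f (μ.restrict (g i '' B)) :=
    (hf.mono hgBI).aemeasurable hgB.measurableSet
  have hfg : AEMeasurable (fun x => f (g i x)) (μ.restrict B) :=
    ((hf.comp hcont (hg.mapsTo i)).mono hBI).aemeasurable hB.measurableSet
  rw [key] at hfm ⊢
  rw [lintegral_map' hfm hae', lintegral_withDensity_eq_lintegral_mul₀ hρm hfg]
  rfl

/-- Induction on the innermost letter, by change of variables and the chain rule. Letting `B` vary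
is needed, as the induction hypothesis is applied to `g i '' B`. -/
theorem IsConformalMeasure.measure_image_wordMap (hμ : IsConformalMeasure g X s μ)
    (hX : IsAttractor g X) (hg : IsSelfConformalIFS g) (hsep : StrongSeparation g X)
    (hs : 0 < s) (w : List Λ) : ∀ B : Set ℝ, IsCompact B → B ⊆ X →
      μ (wordMap g w '' B) =
        ∫⁻ x in B, ENNReal.ofReal (|derivWithin (wordMap g w) (Icc 0 1) x| ^ s) ∂μ := by
  induction w using List.reverseRecOn with
  | nil =>
    intro B hB hBX
    rw [setLIntegral_congr_fun (g := fun _ => 1) hB.measurableSet fun x hx => by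
      rw [derivWithin_wordMap_nil (hX.subset (hBX hx))]; simp]
    simp [wordMap]
  | append_singleton v i ih =>
    intro B hB hBX
    have hcont : ContinuousOn (g i) (Icc 0 1) := (hg.differentiableOn i).continuousOn
    have hBI : B ⊆ Icc 0 1 := hBX.trans hX.subset
    have h1 : wordMap g (v ++ [i]) '' B = wordMap g v '' (g i '' B) := by
      rw [wordMap_append, image_comp]; rfl
    rw [h1, ih _ (hB.image_of_continuousOn (hcont.mono hBI))
      (((hX.mapsTo_wordMap [i]).mono_left hBX).image_subset),
      hμ.setLIntegral_image hX hg hsep i hB hBX]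
    · refine setLIntegral_congr_fun hB.measurableSet fun x hx => ?_
      have h2 := hg.derivWithin_wordMap_append v [i] (hBI hx)
      simp only [h2, abs_mul, Real.mul_rpow (abs_nonneg _) (abs_nonneg _)]
      rw [ENNReal.ofReal_mul (by positivity), mul_comm]
      rfl
    · refine ENNReal.continuous_ofReal.comp_continuousOn ?_
      exact (hg.continuousOn_derivWithin_wordMap v).abs.rpow_const fun _ _ => Or.inr hs.le

theorem IsConformalMeasure.measure_ifsCylinder_le (hμ : IsConformalMeasure g X s μ)
    (hX : IsAttractor g X) (hg : IsSelfConformalIFS g) (hsep : StrongSeparation g X)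
    (hs : 0 < s) (w : List Λ) :
    μ (ifsCylinder g X w) ≤ ENNReal.ofReal (derivNorm g X w ^ s) := by
  rw [ifsCylinder, hμ.measure_image_wordMap hX hg hsep hs w X hX.isCompact subset_rfl]
  calc _ ≤ ∫⁻ _ in X, ENNReal.ofReal (derivNorm g X w ^ s) ∂μ :=
        setLIntegral_mono measurable_const fun x hx => ENNReal.ofReal_le_ofReal
          (Real.rpow_le_rpow (abs_nonneg _) (hX.abs_derivWithin_le_derivNorm hg w hx) hs.le)
    _ = _ := by rw [setLIntegral_const, hμ.measure_attractor, mul_one]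

theorem IsConformalMeasure.exists_le_measure_ifsCylinder (hμ : IsConformalMeasure g X s μ)
    (hX : IsAttractor g X) (hg : IsSelfConformalIFS g) (hsep : StrongSeparation g X)
    (hs : 0 < s) : ∃ c : ℝ, 0 < c ∧ ∀ w : List Λ,
      ENNReal.ofReal ((c * derivNorm g X w) ^ s) ≤ μ (ifsCylinder g X w) := by
  obtain ⟨D, hD, h⟩ := hX.exists_distortion hg
  have hD0 : 0 < D := one_pos.trans_le hD
  refine ⟨D⁻¹, by positivity, fun w => ?_⟩
  have hN := hX.derivNorm_pos hg w
  rw [ifsCylinder, hμ.measure_image_wordMap hX hg hsep hs w X hX.isCompact subset_rfl]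
  calc _ = ∫⁻ _ in X, ENNReal.ofReal ((D⁻¹ * derivNorm g X w) ^ s) ∂μ := by
        rw [setLIntegral_const, hμ.measure_attractor, mul_one]
    _ ≤ _ := setLIntegral_mono' hX.isCompact.measurableSet fun x hx => ENNReal.ofReal_le_ofReal
          (Real.rpow_le_rpow (by positivity)
            ((inv_mul_le_iff₀ hD0).2 (h w x (hX.subset hx)).2) hs.le)

/-- Upper Ahlfors regularity. -/
theorem IsConformalMeasure.exists_measure_ball_le [Nontrivial Λ]
    (hμ : IsConformalMeasure g X s μ) (hX : IsAttractor g X) (hg : IsSelfConformalIFS g)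
    (hsep : StrongSeparation g X) (hδ : IsSeparationConstant g X δ) (hs : 0 < s) :
    ∃ C : ℝ, 0 < C ∧ ∀ x ρ : ℝ, 0 < ρ → μ (Metric.ball x ρ) ≤ ENNReal.ofReal ((C * ρ) ^ s) := by
  have := hμ.isProbabilityMeasure
  obtain ⟨C, hC, hCw⟩ := hX.exists_diam_comparison hg hsep
  obtain ⟨M, hM, hMk⟩ := hX.exists_diam_le_mul_diam_succ hg hsep
  have hC0 : 0 < C := one_pos.trans_le hC
  have hM0 : 0 < M := one_pos.trans_le hM
  have hδ0 := hδ.1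
  have hd : 0 < Metric.diam X := by
    simpa only [ifsCylinder_nil] using hX.diam_ifsCylinder_pos hg hsep []
  have key : ∃ A : ℝ, 0 < A ∧ ∀ x ∈ X, ∀ ρ : ℝ, 0 < ρ →
      μ (Metric.ball x ρ) ≤ ENNReal.ofReal ((A * ρ) ^ s) := by
    -- The first summand serves radii up to `δ * diam X`; the second makes the bound at least `1`
    -- for larger radii.
    refine ⟨C * M / δ + (δ * Metric.diam X)⁻¹, by positivity, fun x hx ρ hρ => ?_⟩
    obtain ⟨i, rfl⟩ := hX.exists_coding_eq hg hx
    by_cases hρ' : ρ ≤ δ * Metric.diam X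
    · have hlim := (hX.tendsto_diam_ifsCylinder hg i).const_mul δ
      rw [mul_zero] at hlim
      -- Stopping level `δ d_{m+1} < ρ ≤ δ d_m`: the ball meets `X` only inside the `m`-th cylinder,
      -- whose diameter is still comparable to `ρ`.
      have hex : ∃ m, δ * Metric.diam (ifsCylinder g X (prefixWord i m)) < ρ :=
        (hlim.eventually_lt_const hρ).exists
      classical
      obtain ⟨m, hm⟩ : ∃ m, Nat.find hex = m + 1 := Nat.exists_eq_succ_of_ne_zero fun h0 => by
        have := Nat.find_spec hex
        rw [h0, prefixWord_zero, ifsCylinder_nil] at this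
        exact absurd this (not_lt.2 hρ')
      have h1 := Nat.find_spec hex
      rw [hm] at h1
      have h2 : ρ ≤ δ * Metric.diam (ifsCylinder g X (prefixWord i m)) :=
        not_lt.1 (Nat.find_min hex (by omega))
      have h3 : Metric.ball (coding g i) ρ ∩ X ⊆ ifsCylinder g X (prefixWord i m) := by
        rintro y ⟨hy, hyX⟩
        refine hδ.mem_ifsCylinder_of_dist_lt hX hg (hX.coding_mem_ifsCylinder hg i m) hyX
          (lt_of_lt_of_le ?_ h2)
        rwa [dist_comm]
      rw [← hμ.measure_inter_eq]
      refine (measure_mono h3).trans ((hμ.measure_ifsCylinder_le hX hg hsep hs _).trans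
        (ENNReal.ofReal_le_ofReal (Real.rpow_le_rpow (hX.derivNorm_pos hg _).le ?_ hs.le)))
      have h4 : Metric.diam (ifsCylinder g X (prefixWord i (m + 1))) ≤ ρ / δ := by
        rw [le_div_iff₀ hδ0, mul_comm]; exact h1.le
      calc _ ≤ C * (M * (ρ / δ)) := (hCw _).2.trans (by
            gcongr; exact (hMk i m).trans (by gcongr))
        _ = C * M / δ * ρ := by ring
        _ ≤ _ := by gcongr; exact le_add_of_nonneg_right (by positivity)
    · refine prob_le_one.trans ?_
      rw [← ENNReal.ofReal_one]
      refine ENNReal.ofReal_le_ofReal (Real.one_le_rpow ?_ hs.le)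
      push Not at hρ'
      calc (1 : ℝ) = (δ * Metric.diam X)⁻¹ * (δ * Metric.diam X) :=
            (inv_mul_cancel₀ (by positivity)).symm
        _ ≤ (δ * Metric.diam X)⁻¹ * ρ := by gcongr
        _ ≤ _ := by gcongr; exact le_add_of_nonneg_left (by positivity)
  obtain ⟨A, hA, h⟩ := key
  -- For an arbitrary centre, a ball meeting `X` lies in the ball of twice the radius about a point
  -- of `X`.
  refine ⟨A * 2, by positivity, fun x ρ hρ => ?_⟩
  rw [← hμ.measure_inter_eq]
  rcases (Metric.ball x ρ ∩ X).eq_empty_or_nonempty with he | ⟨z, hz, hzX⟩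
  · rw [he, measure_empty]; exact zero_le
  · rw [mul_assoc]
    refine (measure_mono ?_).trans (h z hzX (2 * ρ) (by positivity))
    refine inter_subset_left.trans (Metric.ball_subset_ball' ?_)
    rw [Metric.mem_ball, dist_comm] at hz
    linarith

/-- Lower Ahlfors regularity. -/
theorem IsConformalMeasure.exists_le_measure_ball [Nontrivial Λ]
    (hμ : IsConformalMeasure g X s μ) (hX : IsAttractor g X) (hg : IsSelfConformalIFS g)
    (hsep : StrongSeparation g X) (hs : 0 < s) :
    ∃ c : ℝ, 0 < c ∧ ∀ x ∈ X, ∀ ρ : ℝ, 0 < ρ → ρ ≤ Metric.diam X →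
      ENNReal.ofReal ((c * ρ) ^ s) ≤ μ (Metric.ball x ρ) := by
  obtain ⟨C, hC, hCw⟩ := hX.exists_diam_comparison hg hsep
  obtain ⟨M, hM, hMk⟩ := hX.exists_diam_le_mul_diam_succ hg hsep
  obtain ⟨c, hc, hcw⟩ := hμ.exists_le_measure_ifsCylinder hX hg hsep hs
  have hC0 : 0 < C := one_pos.trans_le hC
  have hM0 : 0 < M := one_pos.trans_le hM
  refine ⟨c / (C * M), by positivity, fun x hx ρ hρ hρ' => ?_⟩
  obtain ⟨i, rfl⟩ := hX.exists_coding_eq hg hx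
  -- Stopping level `d_{m+1} < ρ ≤ d_m`: the cylinder of level `m + 1` fits inside the ball.
  have hex : ∃ m, Metric.diam (ifsCylinder g X (prefixWord i m)) < ρ :=
    ((hX.tendsto_diam_ifsCylinder hg i).eventually_lt_const hρ).exists
  classical
  obtain ⟨m, hm⟩ : ∃ m, Nat.find hex = m + 1 := Nat.exists_eq_succ_of_ne_zero fun h0 => by
    have := Nat.find_spec hex
    rw [h0, prefixWord_zero, ifsCylinder_nil] at this
    exact absurd this (not_lt.2 hρ')
  have h1 := Nat.find_spec hex
  rw [hm] at h1
  have h2 : ρ ≤ Metric.diam (ifsCylinder g X (prefixWord i m)) :=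
    not_lt.1 (Nat.find_min hex (by omega))
  have h3 : ifsCylinder g X (prefixWord i (m + 1)) ⊆ Metric.ball (coding g i) ρ := fun y hy =>
    (Metric.dist_le_diam_of_mem (hX.isCompact_ifsCylinder hg _).isBounded hy
      (hX.coding_mem_ifsCylinder hg i (m + 1))).trans_lt h1
  refine le_trans ?_ ((hcw _).trans (measure_mono h3))
  refine ENNReal.ofReal_le_ofReal (Real.rpow_le_rpow (by positivity) ?_ hs.le)
  rw [div_mul_eq_mul_div, div_le_iff₀ (by positivity), mul_assoc]
  gcongr
  calc ρ ≤ _ := h2.trans (hMk i m)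
    _ ≤ M * (C * derivNorm g X (prefixWord i (m + 1))) := by gcongr; exact (hCw _).1
    _ = _ := by ring

theorem IsConformalMeasure.measure_singleton [Nontrivial Λ]
    (hμ : IsConformalMeasure g X s μ) (hX : IsAttractor g X) (hg : IsSelfConformalIFS g)
    (hsep : StrongSeparation g X) (hδ : IsSeparationConstant g X δ) (hs : 0 < s) (x : ℝ) :
    μ {x} = 0 := by
  obtain ⟨C, hC, h⟩ := hμ.exists_measure_ball_le hX hg hsep hδ hs
  have hlim : Tendsto (fun ρ : ℝ => ENNReal.ofReal ((C * ρ) ^ s)) (𝓝[>] 0) (𝓝 0) := by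
    have h1 : Continuous fun ρ : ℝ => ENNReal.ofReal ((C * ρ) ^ s) :=
      ENNReal.continuous_ofReal.comp ((continuous_const.mul continuous_id).rpow_const
        fun _ => Or.inr hs.le)
    simpa [Real.zero_rpow hs.ne'] using (h1.tendsto 0).mono_left nhdsWithin_le_nhds
  refine le_antisymm (ge_of_tendsto hlim ?_) zero_le
  filter_upwards [self_mem_nhdsWithin] with ρ hρ
  exact (measure_mono (singleton_subset_iff.2 (Metric.mem_ball_self hρ))).trans (h x ρ hρ)

end ConformalMeasure

/-! ### First indices below a threshold, and the extended exponential. -/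

section FirstIndex

variable {r : ℕ → ℝ} {ρ : ℝ}

theorem firstIndex_spec (hr_lim : Tendsto r atTop (𝓝 0)) (hρ : 0 < ρ) :
    1 ≤ firstIndex r ρ ∧ r (firstIndex r ρ) < ρ :=
  Nat.sInf_mem ((eventually_ge_atTop 1).and (hr_lim.eventually_lt_const hρ)).exists

theorem lt_of_firstIndex_le (hr_anti : AntitoneOn r (Ici 1)) (hr_lim : Tendsto r atTop (𝓝 0))
    (hρ : 0 < ρ) {n : ℕ} (hn : firstIndex r ρ ≤ n) : r n < ρ :=
  have h := firstIndex_spec hr_lim hρ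
  (hr_anti h.1 (h.1.trans hn) hn).trans_lt h.2

theorem lt_firstIndex_of_le (hr_anti : AntitoneOn r (Ici 1)) (hr_lim : Tendsto r atTop (𝓝 0))
    (hρ : 0 < ρ) {n : ℕ} (hn : ρ ≤ r n) : n < firstIndex r ρ :=
  not_le.1 fun h => not_lt.2 hn (lt_of_firstIndex_le hr_anti hr_lim hρ h)

theorem firstIndex_le {n : ℕ} (hn : 1 ≤ n) (h : r n < ρ) : firstIndex r ρ ≤ n :=
  Nat.sInf_le ⟨hn, h⟩

end FirstIndex

section Exp

theorem exp_coe_add (a b : ℝ≥0∞) :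
    EReal.exp ((a + b : ℝ≥0∞) : EReal) = EReal.exp (a : EReal) * EReal.exp (b : EReal) := by
  rw [EReal.coe_ennreal_add, EReal.exp_add]

theorem exp_coe_mono {a b : ℝ≥0∞} (h : a ≤ b) :
    EReal.exp (a : EReal) ≤ EReal.exp (b : EReal) :=
  EReal.exp_monotone (EReal.coe_ennreal_le_coe_ennreal_iff.2 h)

theorem exp_coe_lt_top {a : ℝ≥0∞} (h : a < ∞) : EReal.exp (a : EReal) < ∞ := by
  rw [EReal.exp_lt_top_iff, ← EReal.coe_ennreal_top]
  exact EReal.coe_ennreal_lt_coe_ennreal_iff.2 h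

theorem measurable_exp_coe : Measurable fun a : ℝ≥0∞ => EReal.exp (a : EReal) :=
  EReal.exp_monotone.measurable.comp measurable_coe_ennreal_ereal

end Exp

/-! ### The energy kernel; from finite potential to positive capacity. -/

section Kernel

variable {μ ν : Measure ℝ} {r : ℕ → ℝ}

/-- The exponent of the kernel defining the energy. -/
noncomputable def overlapSum (μ : Measure ℝ) (r : ℕ → ℝ) (x y : ℝ) : ℝ≥0∞ :=
  ∑' n : ℕ+, μ (Metric.ball x (r n) ∩ Metric.ball y (r n))

theorem energy_eq (μ : Measure ℝ) (r : ℕ → ℝ) (ν : Measure ℝ) :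
    energy μ r ν = ∫⁻ x, ∫⁻ y, EReal.exp (overlapSum μ r x y : EReal) ∂ν ∂ν := rfl

theorem measurable_overlapSum [SFinite μ] (r : ℕ → ℝ) :
    Measurable fun p : ℝ × ℝ => overlapSum μ r p.1 p.2 := by
  refine Measurable.tsum fun n => ?_
  have h : MeasurableSet {q : (ℝ × ℝ) × ℝ | dist q.2 q.1.1 < r n ∧ dist q.2 q.1.2 < r n} := by
    have h1 : Measurable fun q : (ℝ × ℝ) × ℝ => dist q.2 q.1.1 := by fun_prop
    have h2 : Measurable fun q : (ℝ × ℝ) × ℝ => dist q.2 q.1.2 := by fun_prop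
    exact (measurableSet_lt h1 measurable_const).inter (measurableSet_lt h2 measurable_const)
  exact measurable_measure_prodMk_left h

theorem measurable_potential [SFinite μ] [SFinite ν] (r : ℕ → ℝ) :
    Measurable fun x => ∫⁻ y, EReal.exp (overlapSum μ r x y : EReal) ∂ν :=
  (measurable_exp_coe.comp (measurable_overlapSum r)).lintegral_prod_right'

theorem tsum_pnat_le_tsum_indicator {f : ℕ+ → ℝ≥0∞} {F : ℕ → ℝ≥0∞} (h : ∀ n : ℕ+, f n ≤ F n) :
    ∑' n, f n ≤ ∑' n, F n :=
  (ENNReal.tsum_le_tsum h).trans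
    (ENNReal.tsum_comp_le_tsum_of_injective PNat.coe_injective F)

theorem tsum_indicator_coe_finset (T : Finset ℕ) (F : ℕ → ℝ≥0∞) :
    ∑' n, (T : Set ℕ).indicator F n = ∑ n ∈ T, F n := by
  rw [← tsum_subtype, Finset.tsum_subtype']

/-- Balls whose centres are `η` apart meet only if `r n > η / 2`, which leaves finitely many terms,
each at most `1`. -/
theorem overlapSum_lt_top [IsProbabilityMeasure μ] (hr_anti : AntitoneOn r (Ici 1))
    (hr_lim : Tendsto r atTop (𝓝 0)) {η : ℝ} (hη : 0 < η) :
    ∃ C : ℝ≥0∞, C < ∞ ∧ ∀ x y, η ≤ dist x y → overlapSum μ r x y ≤ C := by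
  refine ⟨∑ n ∈ Finset.range (firstIndex r (η / 2)), 1, by simp, fun x y hxy => ?_⟩
  rw [← tsum_indicator_coe_finset]
  refine tsum_pnat_le_tsum_indicator fun n => ?_
  rcases (Metric.ball x (r n) ∩ Metric.ball y (r n)).eq_empty_or_nonempty with h | ⟨z, hz, hz'⟩
  · rw [h, measure_empty]; exact zero_le
  · rw [indicator_of_mem]
    · exact prob_le_one
    · rw [Metric.mem_ball, dist_comm] at hz
      rw [Metric.mem_ball] at hz'
      have := dist_triangle x z y
      simpa using lt_firstIndex_of_le hr_anti hr_lim (half_pos hη) (by linarith)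

/-- Some sublevel set `{F ≤ M}` of the potential has positive mass. Conditioning `ν` on it raises
the potential by at most the factor `(ν E)⁻¹`, so the energy is finite. -/
theorem exists_capacity_pos_of_potential_lt_top [SFinite μ] {X : Set ℝ} (hX : IsCompact X)
    [IsProbabilityMeasure ν] (hν : ν.support ⊆ X)
    (h : ∀ᵐ x ∂ν, ∫⁻ y, EReal.exp (overlapSum μ r x y : EReal) ∂ν < ∞) :
    0 < capacity μ r X := by
  set F : ℝ → ℝ≥0∞ := fun x => ∫⁻ y, EReal.exp (overlapSum μ r x y : EReal) ∂ν with hF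
  have hFm : Measurable F := measurable_potential r
  obtain ⟨M, hM⟩ : ∃ M : ℕ, 0 < ν {x | F x ≤ M} := by
    by_contra! hcon
    have h0 : ν (⋃ M : ℕ, {x | F x ≤ M}) = 0 :=
      measure_iUnion_null fun M => le_antisymm (hcon M) zero_le
    have h1 : ∀ᵐ x ∂ν, x ∈ ⋃ M : ℕ, {x | F x ≤ M} := by
      filter_upwards [h] with x hx
      obtain ⟨n, hn⟩ := ENNReal.exists_nat_gt hx.ne
      exact mem_iUnion_of_mem n hn.le
    obtain ⟨x, hx, hx'⟩ := (h1.and (measure_eq_zero_iff_ae_notMem.1 h0)).exists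
    exact hx' hx
  set E : Set ℝ := {x | F x ≤ M} with hE
  have hEm : MeasurableSet E := measurableSet_le hFm measurable_const
  set ν' : Measure ℝ := ProbabilityTheory.cond ν E with hν'
  have hprob : IsProbabilityMeasure ν' := ProbabilityTheory.cond_isProbabilityMeasure hM.ne'
  have hsupp : ν'.support ⊆ X :=
    (Measure.AbsolutelyContinuous.support_mono ProbabilityTheory.cond_absolutelyContinuous).trans hν
  have hen : energy μ r ν' < ∞ := by
    have hinv : (ν E)⁻¹ < ∞ := ENNReal.inv_lt_top.2 hM
    have h1 : ∀ x ∈ E, ∫⁻ y, EReal.exp (overlapSum μ r x y : EReal) ∂ν' ≤ (ν E)⁻¹ * M := by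
      intro x hx
      rw [hν', ProbabilityTheory.cond, lintegral_smul_measure, smul_eq_mul]
      gcongr
      exact (setLIntegral_le_lintegral _ _).trans hx
    calc energy μ r ν'
        = (ν E)⁻¹ * ∫⁻ x in E, ∫⁻ y, EReal.exp (overlapSum μ r x y : EReal) ∂ν' ∂ν := by
          rw [energy_eq]
          conv_lhs => rw [hν', ProbabilityTheory.cond, lintegral_smul_measure, smul_eq_mul]
          rfl
      _ ≤ (ν E)⁻¹ * ∫⁻ x in E, (ν E)⁻¹ * M ∂ν := by
          exact mul_le_mul' le_rfl (setLIntegral_mono measurable_const h1)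
      _ < ∞ := by
          rw [setLIntegral_const]
          exact ENNReal.mul_lt_top hinv (ENNReal.mul_lt_top
            (ENNReal.mul_lt_top hinv (ENNReal.natCast_lt_top M)) (measure_lt_top _ _))
  refine (ENNReal.inv_pos.2 hen.ne).trans_le ?_
  exact le_iSup_of_le ν' (le_iSup_of_le hprob (le_iSup_of_le hsupp (le_iSup_of_le
    (hX.of_isClosed_subset Measure.isClosed_support hsupp) le_rfl)))

end Kernel

/-! ### Symbolic annuli around a point. -/

section Annulus

variable {Λ : Type*} [Nonempty Λ] {g : Λ → ℝ → ℝ} {X : Set ℝ} {δ : ℝ}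

theorem IsAttractor.measurableSet_annulus (hX : IsAttractor g X) (hg : IsSelfConformalIFS g)
    (k : ℕ) (x : ℝ) : MeasurableSet (annulus g X k x) :=
  (hX.isCompact_ifsCylinder hg _).measurableSet.diff (hX.isCompact_ifsCylinder hg _).measurableSet

theorem IsAttractor.mem_ifsCylinder_address [Finite Λ] (hX : IsAttractor g X)
    (hg : IsSelfConformalIFS g) {x : ℝ} (hx : x ∈ X) (k : ℕ) : x ∈ ifsCylinder g X (prefixWord (address g x) k) := by
  have h := hX.coding_mem_ifsCylinder hg (address g x) k
  rwa [hX.coding_address hg hx] at h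

theorem IsSeparationConstant.mul_diam_le_dist_of_mem_annulus [Finite Λ]
    (hδ : IsSeparationConstant g X δ)
    (hX : IsAttractor g X) (hg : IsSelfConformalIFS g) {x y : ℝ} (hx : x ∈ X) {k : ℕ}
    (hy : y ∈ annulus g X k x) :
    δ * Metric.diam (ifsCylinder g X (prefixWord (address g x) (k + 1))) ≤ dist x y := by
  by_contra! h
  exact hy.2 (hδ.mem_ifsCylinder_of_dist_lt hX hg (hX.mem_ifsCylinder_address hg hx _)
    (hX.ifsCylinder_subset _ hy.1) h)

theorem IsAttractor.subset_union_annulus [Finite Λ] (hX : IsAttractor g X)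
    (hg : IsSelfConformalIFS g) {x : ℝ} (hx : x ∈ X) :
    X ⊆ ({x} ∪ annulus g X 0 x) ∪ ⋃ k : ℕ+, annulus g X k x := by
  intro y hy
  by_cases h : ∀ k, y ∈ ifsCylinder g X (prefixWord (address g x) k)
  · refine Or.inl (Or.inl ?_)
    rw [mem_singleton_iff, ← hX.coding_eq hg h, hX.coding_address hg hx]
  push Not at h
  classical
  obtain ⟨k, hk⟩ : ∃ k, Nat.find h = k + 1 := Nat.exists_eq_succ_of_ne_zero fun h0 => by
    have := Nat.find_spec h
    rw [h0, prefixWord_zero, ifsCylinder_nil] at this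
    exact this hy
  have hmem : y ∈ annulus g X k x :=
    ⟨not_not.1 (Nat.find_min h (by omega)), hk ▸ Nat.find_spec h⟩
  rcases k.eq_zero_or_pos with rfl | hk0
  · exact Or.inl (Or.inr hmem)
  · exact Or.inr (mem_iUnion_of_mem ⟨k, hk0⟩ hmem)

end Annulus

/-! ### Upper bound for the overlap sum; sufficiency of the series condition. -/

section Estimates

variable {Λ : Type*} [Fintype Λ] [Nontrivial Λ] {g : Λ → ℝ → ℝ} {X : Set ℝ} {δ s : ℝ}
  {μ ν : Measure ℝ} {r : ℕ → ℝ}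

/-- Beyond the upper index, only radii between about `δ d_{k+1} / 2` and `δ d_k` contribute. These
span at most `m + 1` scales, where `m` further letters halve every diameter. -/
theorem exists_overlapSum_le
    (hg : IsSelfConformalIFS g) (hX : IsAttractor g X) (hsep : StrongSeparation g X)
    (hδ : IsSeparationConstant g X δ) (hμ : IsConformalMeasure g X s μ)
    (hr_anti : AntitoneOn r (Ici 1)) (hr_lim : Tendsto r atTop (𝓝 0))
    (hsums : BoundedCylinderSums g X δ μ r) (hprod : BoundedProducts g X s r) :
    ∃ C : ℝ≥0∞, C < ∞ ∧ ∀ (i : ℕ → Λ) (k : ℕ) (y : ℝ),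
      δ * Metric.diam (ifsCylinder g X (prefixWord i (k + 1))) ≤ dist (coding g i) y →
      overlapSum μ r (coding g i) y ≤
        ∑ n ∈ Finset.Icc 1 (upperIndex g X δ r i k), μ (Metric.ball (coding g i) (r n)) + C := by
  have hs := hμ.pressure_eq_zero.pos_of_zero hX hg hsep
  obtain ⟨C₁, hC₁⟩ := hsums
  obtain ⟨C₂, hC₂⟩ := hprod
  obtain ⟨m, hm⟩ := hX.exists_diam_add_le_half hg hsep
  have hδ0 := hδ.1
  refine ⟨∑ _j ∈ Finset.range (m + 1), (C₁ : ℝ≥0∞) +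
    ∑ _j ∈ Finset.range (m + 1), ENNReal.ofReal C₂, ?_, fun i k y hy => ?_⟩
  · rw [ENNReal.add_lt_top, ENNReal.sum_lt_top, ENNReal.sum_lt_top]
    exact ⟨fun _ _ => ENNReal.coe_lt_top, fun _ _ => ENNReal.ofReal_lt_top⟩
  set x := coding g i with hx
  set d : ℕ → ℝ := fun k => Metric.diam (ifsCylinder g X (prefixWord i k)) with hd
  have hd0 : ∀ k, 0 < d k := fun k => hX.diam_ifsCylinder_pos hg hsep _
  set b : ℕ → ℝ≥0∞ := fun n => μ (Metric.ball x (r n)) with hb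
  have hpt : ∀ n : ℕ+, μ (Metric.ball x (r n) ∩ Metric.ball y (r n)) ≤
      (Finset.Icc 1 (upperIndex g X δ r i k) : Set ℕ).indicator b n +
      (∑ j ∈ Finset.range (m + 1), (scaleIndices g X δ r i (k + j + 1)).indicator b n +
      ∑ j ∈ Finset.range (m + 1), (Finset.range (lowerIndex g X r i (k + j + 1)) : Set ℕ).indicator
        (fun _ => μ (ifsCylinder g X (prefixWord i (k + j)))) n) := by
    intro n
    have hle : μ (Metric.ball x (r n) ∩ Metric.ball y (r n)) ≤ b n := measure_mono inter_subset_left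
    by_cases hn : (n : ℕ) ≤ upperIndex g X δ r i k
    · refine le_add_right ?_
      rwa [indicator_of_mem]
      simpa using ⟨n.pos, hn⟩
    refine le_add_left ?_
    rcases (Metric.ball x (r n) ∩ Metric.ball y (r n)).eq_empty_or_nonempty with h | ⟨z, hz, hz'⟩
    · rw [h, measure_empty]; exact zero_le
    rw [Metric.mem_ball, dist_comm] at hz
    rw [Metric.mem_ball] at hz'
    have htri := dist_triangle x z y
    have h1 : r n < δ * d k := lt_of_firstIndex_le hr_anti hr_lim (mul_pos hδ0 (hd0 k))
      (not_le.1 hn).le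
    have h2 : δ * d (k + (m + 1)) ≤ r n := by
      have h3 : d (k + (m + 1)) ≤ d (k + 1) / 2 := by
        have := hm i (k + 1)
        rwa [show k + 1 + m = k + (m + 1) by ring] at this
      have h4 := mul_le_mul_of_nonneg_left h3 hδ0.le
      have h5 : δ * d (k + 1) ≤ dist x y := hy
      linarith
    -- The least such level is `j + 1` with `j ≤ m`, which puts `r n` in `[δ d_{k+j+1}, δ d_{k+j})`.
    have hex : ∃ j, δ * d (k + j) ≤ r n := ⟨m + 1, h2⟩
    classical
    obtain ⟨j, hj⟩ : ∃ j, Nat.find hex = j + 1 := Nat.exists_eq_succ_of_ne_zero fun h0 => by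
      have := Nat.find_spec hex
      rw [h0] at this
      exact absurd this (not_le.2 h1)
    have hjm : j < m + 1 := by
      have := Nat.find_min' hex h2
      omega
    have h3 := Nat.find_spec hex
    rw [hj] at h3
    have h4 : r n < δ * d (k + j) := not_le.1 (Nat.find_min hex (by omega))
    -- If so, `n` is an index of scale `k + j + 1`. Otherwise `d_{k+j} ≤ r n < δ d_{k+j}`, which
    -- occurs only for `δ > 1`. Then the ball meets `X` inside one cylinder and `n` is below the
    -- lower index, so the bounded products apply.
    by_cases h5 : r n < d (k + j)
    · refine le_add_right (le_trans ?_ (Finset.single_le_sum_of_canonicallyOrdered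
        (Finset.mem_range.2 hjm)))
      rwa [indicator_of_mem]
      exact ⟨n.pos, h3, h5⟩
    · refine le_add_left (le_trans ?_ (Finset.single_le_sum_of_canonicallyOrdered
        (Finset.mem_range.2 hjm)))
      rw [indicator_of_mem]
      · refine hle.trans ?_
        change μ (Metric.ball x (r n)) ≤ _
        rw [← hμ.measure_inter_eq (Metric.ball x (r n))]
        refine measure_mono fun z hz => ?_
        refine hδ.mem_ifsCylinder_of_dist_lt hX hg (hX.coding_mem_ifsCylinder hg i _) hz.2
          (lt_trans ?_ h4)
        rw [dist_comm]
        exact hz.1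
      · exact Finset.mem_coe.2 (Finset.mem_range.2
          (lt_firstIndex_of_le hr_anti hr_lim (hd0 (k + j)) (not_lt.1 h5)))
  refine (tsum_pnat_le_tsum_indicator
    (F := fun n => (Finset.Icc 1 (upperIndex g X δ r i k) : Set ℕ).indicator b n +
      (∑ j ∈ Finset.range (m + 1), (scaleIndices g X δ r i (k + j + 1)).indicator b n +
      ∑ j ∈ Finset.range (m + 1), (Finset.range (lowerIndex g X r i (k + j + 1)) : Set ℕ).indicator
        (fun _ => μ (ifsCylinder g X (prefixWord i (k + j)))) n)) hpt).trans ?_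
  rw [ENNReal.tsum_add, ENNReal.tsum_add, tsum_indicator_coe_finset,
    Summable.tsum_finsetSum fun _ _ => ENNReal.summable,
    Summable.tsum_finsetSum fun _ _ => ENNReal.summable]
  gcongr with j hj j hj
  · rw [← tsum_subtype]
    exact hC₁ i (k + j + 1) (by omega)
  · rw [tsum_indicator_coe_finset, Finset.sum_const, Finset.card_range, nsmul_eq_mul]
    calc _ ≤ (lowerIndex g X r i (k + j + 1) : ℝ≥0∞) *
          ENNReal.ofReal (derivNorm g X (prefixWord i (k + j)) ^ s) := by
          gcongr
          exact hμ.measure_ifsCylinder_le hX hg hsep hs _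
      _ = ENNReal.ofReal (lowerIndex g X r i (k + j + 1) *
          derivNorm g X (prefixWord i (k + j)) ^ s) := by
          rw [ENNReal.ofReal_mul (Nat.cast_nonneg _), ENNReal.ofReal_natCast]
      _ ≤ _ := ENNReal.ofReal_le_ofReal (hC₂ i (k + j + 1) (by omega))

theorem capacity_pos_of_annulus_sum_lt_top
    (hg : IsSelfConformalIFS g) (hX : IsAttractor g X) (hsep : StrongSeparation g X)
    (hδ : IsSeparationConstant g X δ) (hμ : IsConformalMeasure g X s μ)
    (hr_anti : AntitoneOn r (Ici 1)) (hr_lim : Tendsto r atTop (𝓝 0))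
    (hsums : BoundedCylinderSums g X δ μ r) (hprod : BoundedProducts g X s r)
    [IsProbabilityMeasure ν] (hν : ν.support ⊆ X) (hatom : ∀ x, ν {x} = 0)
    (h : ∀ᵐ x ∂ν, ∑' k : ℕ+, ν (annulus g X k x) *
      EReal.exp ((∑ n ∈ Finset.Icc 1 (upperIndex g X δ r (address g x) k),
        μ (Metric.ball x (r n)) : ℝ≥0∞) : EReal) < ∞) :
    0 < capacity μ r X := by
  have := hμ.isProbabilityMeasure
  have hνX : ν Xᶜ = 0 := measure_mono_null (compl_subset_compl.2 hν) Measure.measure_compl_support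
  refine exists_capacity_pos_of_potential_lt_top hX.isCompact hν ?_
  obtain ⟨C, hC, hle⟩ := exists_overlapSum_le hg hX hsep hδ hμ hr_anti hr_lim hsums hprod
  have hXae : ∀ᵐ x ∂ν, x ∈ X := hνX
  filter_upwards [h, hXae] with x hx hxX
  have hres : ν.restrict X = ν := Measure.restrict_eq_self_of_ae_mem hXae
  set F : ℝ → ℝ≥0∞ := fun y => EReal.exp (overlapSum μ r x y : EReal) with hF
  set S : ℕ+ → ℝ≥0∞ := fun k => EReal.exp ((∑ n ∈ Finset.Icc 1
    (upperIndex g X δ r (address g x) k), μ (Metric.ball x (r n)) : ℝ≥0∞) : EReal) with hS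
  have hcod := hX.coding_address hg hxX
  -- The kernel may be infinite on the diagonal; this is where non-atomicity enters.
  have h1 : ∫⁻ y in {x}, F y ∂ν = 0 := setLIntegral_measure_zero _ _ (hatom x)
  -- The series starts at `k = 1`. On the outermost annulus `y` stays a fixed distance from `x`, so
  -- the kernel is bounded there.
  have h2 : ∫⁻ y in annulus g X 0 x, F y ∂ν < ∞ := by
    obtain ⟨C', hC', hle'⟩ := overlapSum_lt_top (μ := μ) hr_anti hr_lim (mul_pos hδ.1
      (hX.diam_ifsCylinder_pos hg hsep (prefixWord (address g x) 1)))
    calc _ ≤ ∫⁻ _ in annulus g X 0 x, EReal.exp (C' : EReal) ∂ν :=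
          setLIntegral_mono measurable_const fun y hy => exp_coe_mono
            (hle' x y (hδ.mul_diam_le_dist_of_mem_annulus hX hg hxX hy))
      _ < ∞ := by
        rw [setLIntegral_const]
        exact ENNReal.mul_lt_top (exp_coe_lt_top hC') (measure_lt_top _ _)
  have h3 : ∀ k : ℕ+, ∫⁻ y in annulus g X k x, F y ∂ν ≤
      EReal.exp (C : EReal) * (ν (annulus g X k x) * S k) := by
    intro k
    calc _ ≤ ∫⁻ _ in annulus g X k x, S k * EReal.exp (C : EReal) ∂ν :=
          setLIntegral_mono measurable_const fun y hy => by
            have h4 := hle (address g x) k y (by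
              rw [hcod]; exact hδ.mul_diam_le_dist_of_mem_annulus hX hg hxX hy)
            rw [hcod] at h4
            rw [hS, ← exp_coe_add]
            exact exp_coe_mono h4
      _ = _ := by rw [setLIntegral_const]; ring
  calc ∫⁻ y, F y ∂ν = ∫⁻ y in X, F y ∂ν := by rw [hres]
    _ ≤ ∫⁻ y in ({x} ∪ annulus g X 0 x) ∪ ⋃ k : ℕ+, annulus g X k x, F y ∂ν :=
      lintegral_mono_set (hX.subset_union_annulus hg hxX)
    _ ≤ (∫⁻ y in {x}, F y ∂ν + ∫⁻ y in annulus g X 0 x, F y ∂ν) +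
        ∑' k : ℕ+, ∫⁻ y in annulus g X k x, F y ∂ν :=
      (lintegral_union_le _ _ _).trans
        (add_le_add (lintegral_union_le _ _ _) (lintegral_iUnion_le _ _))
    _ ≤ (0 + ∫⁻ y in annulus g X 0 x, F y ∂ν) +
        ∑' k : ℕ+, EReal.exp (C : EReal) * (ν (annulus g X k x) * S k) := by
      rw [h1]
      gcongr with k
      exact h3 k
    _ < ∞ := by
      rw [zero_add, ENNReal.tsum_mul_left, ENNReal.add_lt_top]
      exact ⟨h2, ENNReal.mul_lt_top (exp_coe_lt_top hC) hx⟩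

end Estimates

/-! ### Comparison of balls, disjoint annuli, and the exclusion of atoms. -/

theorem sum_Icc_le_tsum_pnat (F : ℕ → ℝ≥0∞) (N : ℕ) :
    ∑ n ∈ Finset.Icc 1 N, F n ≤ ∑' n : ℕ+, F n := by
  have h : ∑' n : ℕ+, F n = ∑' n, {n : ℕ | 0 < n}.indicator F n := tsum_subtype {n : ℕ | 0 < n} F
  rw [h]
  refine le_trans (Finset.sum_le_sum fun n hn => ?_) (ENNReal.sum_le_tsum (Finset.Icc 1 N))
  rw [indicator_of_mem]
  exact (Finset.mem_Icc.1 hn).1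

/-- On the line, what the shifted interval misses lies at one end, between the two corresponding
endpoints; `z` is the endpoint of `B(y, ρ)` there. -/
theorem ball_diff_ball_subset (x y ρ d : ℝ) (hxy : dist x y ≤ d) :
    ∃ z, Metric.ball x ρ ⊆ (Metric.ball x ρ ∩ Metric.ball y ρ) ∪ Metric.ball z d := by
  rcases le_total x y with h | h
  · refine ⟨y - ρ, fun z hz => ?_⟩
    by_cases hzy : z ∈ Metric.ball y ρ
    · exact Or.inl ⟨hz, hzy⟩
    · refine Or.inr ?_
      rw [Real.dist_eq, abs_le] at hxy
      rw [Metric.mem_ball, Real.dist_eq, abs_lt] at hz hzy ⊢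
      by_cases hz1 : -ρ < z - y
      · exact absurd ⟨hz1, by linarith [hz.2]⟩ hzy
      · constructor <;> linarith [hz.1, hxy.1]
  · refine ⟨y + ρ, fun z hz => ?_⟩
    by_cases hzy : z ∈ Metric.ball y ρ
    · exact Or.inl ⟨hz, hzy⟩
    · refine Or.inr ?_
      rw [Real.dist_eq, abs_le] at hxy
      rw [Metric.mem_ball, Real.dist_eq, abs_lt] at hz hzy ⊢
      by_cases hz1 : z - y < ρ
      · exact absurd ⟨by linarith [hz.1], hz1⟩ hzy
      · constructor <;> linarith [hz.2, hxy.2]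

section AnnulusDisjoint

variable {Λ : Type*} [Nonempty Λ] {g : Λ → ℝ → ℝ} {X : Set ℝ}

theorem IsAttractor.pairwise_disjoint_annulus (hX : IsAttractor g X) (x : ℝ) :
    Pairwise (Function.onFun Disjoint fun k : ℕ+ => annulus g X k x) := by
  have key : ∀ k l : ℕ+, k < l → Disjoint (annulus g X k x) (annulus g X l x) := by
    intro k l hkl
    refine disjoint_left.2 fun y hy hy' => hy.2 ?_
    exact hX.ifsCylinder_prefixWord_antitone (address g x)
      (Nat.succ_le_of_lt (PNat.coe_lt_coe _ _ |>.2 hkl)) hy'.1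
  intro k l hkl
  rcases lt_or_gt_of_ne hkl with h | h
  · exact key k l h
  · exact (key l k h).symm

theorem IsAttractor.dist_le_of_mem_annulus [Finite Λ] (hX : IsAttractor g X)
    (hg : IsSelfConformalIFS g) {x y : ℝ} (hx : x ∈ X) {k : ℕ} (hy : y ∈ annulus g X k x) :
    dist x y ≤ Metric.diam (ifsCylinder g X (prefixWord (address g x) k)) :=
  Metric.dist_le_diam_of_mem (hX.isCompact_ifsCylinder hg _).isBounded
    (hX.mem_ifsCylinder_address hg hx k) hy.1

/-- The exponential factors are bounded, and the disjoint annuli have total mass at most `1`. -/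
theorem annulus_sum_lt_top_of_sum_le {δ : ℝ} {μ : Measure ℝ} {r : ℕ → ℝ}
    (hX : IsAttractor g X) (hg : IsSelfConformalIFS g) [IsProbabilityMeasure μ] {C : ℝ≥0∞} (hC : C < ∞)
    (h : ∀ x N, ∑ n ∈ Finset.Icc 1 N, μ (Metric.ball x (r n)) ≤ C) (x : ℝ) :
    ∑' k : ℕ+, μ (annulus g X k x) *
      EReal.exp ((∑ n ∈ Finset.Icc 1 (upperIndex g X δ r (address g x) k),
        μ (Metric.ball x (r n)) : ℝ≥0∞) : EReal) < ∞ := by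
  calc _ ≤ ∑' k : ℕ+, μ (annulus g X k x) * EReal.exp (C : EReal) :=
        ENNReal.tsum_le_tsum fun k => mul_le_mul' le_rfl (exp_coe_mono (h x _))
    _ = μ (⋃ k : ℕ+, annulus g X k x) * EReal.exp (C : EReal) := by
        rw [ENNReal.tsum_mul_right, measure_iUnion (hX.pairwise_disjoint_annulus x)
          fun k => hX.measurableSet_annulus hg k x]
    _ < ∞ := ENNReal.mul_lt_top (measure_lt_top _ _) (exp_coe_lt_top hC)

end AnnulusDisjoint

/-- The kernel at `(x, x)` is the exponential of the divergent sum, so an atom at `x` would be a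
point of positive mass with infinite potential. -/
theorem measure_singleton_eq_zero_of_potential_lt_top {μ ν : Measure ℝ} {r : ℕ → ℝ} {x : ℝ}
    (hx : ∑' n : ℕ+, μ (Metric.ball x (r n)) = ∞)
    (h : ∀ᵐ x ∂ν, ∫⁻ y, EReal.exp (overlapSum μ r x y : EReal) ∂ν < ∞) : ν {x} = 0 := by
  by_contra h0
  have h1 : ∫⁻ y, EReal.exp (overlapSum μ r x y : EReal) ∂ν = ∞ := by
    refine top_le_iff.1 ?_
    calc ∞ = ∫⁻ y in {x}, EReal.exp (overlapSum μ r x y : EReal) ∂ν := by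
          rw [lintegral_singleton, overlapSum]
          simp only [inter_self]
          rw [hx, EReal.coe_ennreal_top, EReal.exp_top, ENNReal.top_mul h0]
      _ ≤ _ := setLIntegral_le_lintegral _ _
  refine h0 (measure_mono_null (singleton_subset_iff.2 ?_) (ae_iff.1 h))
  simp [h1]

/-! ### Lower bound for the overlap sum; necessity of the series condition. -/

section Estimates

variable {Λ : Type*} [Fintype Λ] [Nontrivial Λ] {g : Λ → ℝ → ℝ} {X : Set ℝ} {δ s : ℝ}
  {μ ν : Measure ℝ} {r : ℕ → ℝ}

/-- The loss from replacing `B(x, r n)` by its overlap with `B(y, r n)` is charged to the products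
when `r n ≥ d_k`, to the cylinder sum of scale `k` when `δ d_k ≤ r n < d_k`, and to the last index
otherwise. -/
theorem exists_sum_le_overlapSum
    (hg : IsSelfConformalIFS g) (hX : IsAttractor g X) (hsep : StrongSeparation g X)
    (hδ : IsSeparationConstant g X δ) (hμ : IsConformalMeasure g X s μ)
    (hr_anti : AntitoneOn r (Ici 1)) (hr_lim : Tendsto r atTop (𝓝 0))
    (hsums : BoundedCylinderSums g X δ μ r) (hprod : BoundedProducts g X s r) :
    ∃ C : ℝ≥0∞, C < ∞ ∧ ∀ (i : ℕ → Λ) (k : ℕ) (y : ℝ), 1 ≤ k →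
      dist (coding g i) y ≤ Metric.diam (ifsCylinder g X (prefixWord i k)) →
      ∑ n ∈ Finset.Icc 1 (upperIndex g X δ r i k), μ (Metric.ball (coding g i) (r n)) ≤
        overlapSum μ r (coding g i) y + C := by
  have := hμ.isProbabilityMeasure
  have hs := hμ.pressure_eq_zero.pos_of_zero hX hg hsep
  obtain ⟨A, hA, hAb⟩ := hμ.exists_measure_ball_le hX hg hsep hδ hs
  obtain ⟨B, hB, hBw⟩ := hX.exists_diam_comparison hg hsep
  have hB0 : 0 < B := one_pos.trans_le hB
  obtain ⟨C₁, hC₁⟩ := hsums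
  obtain ⟨C₂, hC₂⟩ := hprod
  refine ⟨ENNReal.ofReal ((A * B) ^ s * C₂) + (C₁ + 1), ?_, fun i k y hk hy => ?_⟩
  · simp only [ENNReal.add_lt_top]
    exact ⟨ENNReal.ofReal_lt_top, ENNReal.coe_lt_top, ENNReal.one_lt_top⟩
  set x := coding g i with hx
  set d : ℕ → ℝ := fun k => Metric.diam (ifsCylinder g X (prefixWord i k)) with hd
  have hd0 : ∀ k, 0 < d k := fun k => hX.diam_ifsCylinder_pos hg hsep _
  set b : ℕ → ℝ≥0∞ := fun n => μ (Metric.ball x (r n)) with hb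
  set N := upperIndex g X δ r i k with hN
  set f : ℕ → ℝ≥0∞ := fun n => μ (Metric.ball x (r n) ∩ Metric.ball y (r n)) with hf
  have hpt : ∀ n ∈ Finset.Icc 1 N, b n ≤ f n +
      ((Finset.range (lowerIndex g X r i (k + 1)) : Set ℕ).indicator
        (fun _ => ENNReal.ofReal ((A * d k) ^ s)) n +
      ((scaleIndices g X δ r i k).indicator b n + ((({N} : Finset ℕ) : Set ℕ).indicator
        (fun _ => 1) n))) := by
    intro n hn
    rw [Finset.mem_Icc] at hn
    -- Such `n` precede the lower index of level `k + 1`, which is the first with `r n < d k`; each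
    -- loses at most the mass of a ball of radius `d k`.
    by_cases h1 : d k ≤ r n
    · obtain ⟨z, hz⟩ := ball_diff_ball_subset x y (r n) (d k) hy
      rw [indicator_of_mem (a := n) (s := (Finset.range (lowerIndex g X r i (k + 1)) : Set ℕ))
        (Finset.mem_coe.2 (Finset.mem_range.2 (lt_firstIndex_of_le hr_anti hr_lim (hd0 k) h1))),
        ← add_assoc]
      exact le_add_right ((measure_mono hz).trans ((measure_union_le _ _).trans
        (add_le_add le_rfl (hAb z _ (hd0 k)))))
    · refine le_add_left (le_add_left ?_)
      by_cases h2 : δ * d k ≤ r n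
      · refine le_add_right ?_
        rw [indicator_of_mem]
        exact ⟨hn.1, h2, (not_le.1 h1).trans_le
          (hX.diam_ifsCylinder_prefixWord_antitone hg i (Nat.sub_le k 1))⟩
      -- Here `r n < δ d_k` with `n ≤ N`, and `N` is the first such index, so `n = N`: the sum
      -- includes the upper index, at a cost of at most `1`.
      · refine le_add_left ?_
        rw [indicator_of_mem]
        · exact prob_le_one
        · exact Finset.mem_coe.2 (Finset.mem_singleton.2
            (le_antisymm hn.2 (firstIndex_le hn.1 (not_le.1 h2))))
  calc _ ≤ _ := Finset.sum_le_sum hpt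
    _ ≤ _ := ?_
  rw [Finset.sum_add_distrib, Finset.sum_add_distrib, Finset.sum_add_distrib]
  refine add_le_add (sum_Icc_le_tsum_pnat f N) (add_le_add ((ENNReal.sum_le_tsum _).trans ?_)
    (add_le_add ((ENNReal.sum_le_tsum _).trans ?_) ((ENNReal.sum_le_tsum _).trans ?_)))
  · rw [tsum_indicator_coe_finset, Finset.sum_const, Finset.card_range, nsmul_eq_mul,
      ← ENNReal.ofReal_natCast, ← ENNReal.ofReal_mul (Nat.cast_nonneg _)]
    refine ENNReal.ofReal_le_ofReal ?_
    have hNw := hX.derivNorm_pos hg (prefixWord i k)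
    calc (lowerIndex g X r i (k + 1) : ℝ) * (A * d k) ^ s
        ≤ lowerIndex g X r i (k + 1) * (A * (B * derivNorm g X (prefixWord i k))) ^ s := by
          have h := (hBw (prefixWord i k)).1
          have := hd0 k
          gcongr
      _ = (A * B) ^ s * (lowerIndex g X r i (k + 1) * derivNorm g X (prefixWord i k) ^ s) := by
          rw [← mul_assoc A, Real.mul_rpow (by positivity) hNw.le]
          ring
      _ ≤ _ := by
          gcongr
          exact hC₂ i (k + 1) (by omega)
  · rw [← tsum_subtype]
    exact hC₁ i k hk
  · rw [tsum_indicator_coe_finset, Finset.sum_singleton]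

/-- By two-sided Ahlfors regularity, a ball of radius at most `diam X` has mass at most `(A / c) ^
s` times that of the ball of equal radius about `x₀`. The finitely many larger radii contribute at
most `1` each. -/
theorem exists_sum_le_of_tsum_lt_top
    (hg : IsSelfConformalIFS g) (hX : IsAttractor g X) (hsep : StrongSeparation g X)
    (hδ : IsSeparationConstant g X δ) (hμ : IsConformalMeasure g X s μ)
    (hr_pos : ∀ n, 1 ≤ n → 0 < r n)
    (hr_anti : AntitoneOn r (Ici 1)) (hr_lim : Tendsto r atTop (𝓝 0)) {x₀ : ℝ} (hx₀ : x₀ ∈ X)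
    (h : ∑' n : ℕ+, μ (Metric.ball x₀ (r n)) < ∞) :
    ∃ C : ℝ≥0∞, C < ∞ ∧ ∀ x N, ∑ n ∈ Finset.Icc 1 N, μ (Metric.ball x (r n)) ≤ C := by
  have := hμ.isProbabilityMeasure
  have hs := hμ.pressure_eq_zero.pos_of_zero hX hg hsep
  obtain ⟨A, hA, hAb⟩ := hμ.exists_measure_ball_le hX hg hsep hδ hs
  obtain ⟨c, hc, hcb⟩ := hμ.exists_le_measure_ball hX hg hsep hs
  have hd : 0 < Metric.diam X := by
    simpa only [ifsCylinder_nil] using hX.diam_ifsCylinder_pos hg hsep []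
  refine ⟨ENNReal.ofReal ((A / c) ^ s) * ∑' n : ℕ+, μ (Metric.ball x₀ (r n)) +
    ∑ n ∈ Finset.range (firstIndex r (Metric.diam X)), 1, ?_, fun x N => ?_⟩
  · rw [ENNReal.add_lt_top]
    exact ⟨ENNReal.mul_lt_top ENNReal.ofReal_lt_top h, by simp⟩
  have hpt : ∀ n ∈ Finset.Icc 1 N, μ (Metric.ball x (r n)) ≤
      ENNReal.ofReal ((A / c) ^ s) * μ (Metric.ball x₀ (r n)) +
        (Finset.range (firstIndex r (Metric.diam X)) : Set ℕ).indicator (fun _ => 1) n := by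
    intro n hn
    have hrn := hr_pos n (Finset.mem_Icc.1 hn).1
    rcases le_total (r n) (Metric.diam X) with h1 | h1
    · refine le_add_right ((hAb x _ hrn).trans ?_)
      calc _ = ENNReal.ofReal ((A / c) ^ s) * ENNReal.ofReal ((c * r n) ^ s) := by
            rw [← ENNReal.ofReal_mul (by positivity),
              ← Real.mul_rpow (by positivity) (by positivity)]
            congr 2
            field_simp
        _ ≤ _ := by gcongr; exact hcb x₀ hx₀ _ hrn h1
    · refine le_add_left ?_
      rw [indicator_of_mem]
      · exact prob_le_one
      · exact Finset.mem_coe.2 (Finset.mem_range.2 (lt_firstIndex_of_le hr_anti hr_lim hd h1))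
  refine (Finset.sum_le_sum hpt).trans ?_
  rw [Finset.sum_add_distrib, ← Finset.mul_sum]
  exact add_le_add
    (mul_le_mul' le_rfl (sum_Icc_le_tsum_pnat (fun n => μ (Metric.ball x₀ (r n))) N))
    ((ENNReal.sum_le_tsum _).trans (tsum_indicator_coe_finset _ _).le)

theorem annulus_sum_lt_top_of_potential_lt_top
    (hX : IsAttractor g X) (hg : IsSelfConformalIFS g) {C : ℝ≥0∞} (hC : C < ∞)
    (hle : ∀ (i : ℕ → Λ) (k : ℕ) (y : ℝ), 1 ≤ k →
      dist (coding g i) y ≤ Metric.diam (ifsCylinder g X (prefixWord i k)) →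
      ∑ n ∈ Finset.Icc 1 (upperIndex g X δ r i k), μ (Metric.ball (coding g i) (r n)) ≤
        overlapSum μ r (coding g i) y + C) {x : ℝ} (hx : x ∈ X)
    (h : ∫⁻ y, EReal.exp (overlapSum μ r x y : EReal) ∂ν < ∞) :
    ∑' k : ℕ+, ν (annulus g X k x) *
      EReal.exp ((∑ n ∈ Finset.Icc 1 (upperIndex g X δ r (address g x) k),
        μ (Metric.ball x (r n)) : ℝ≥0∞) : EReal) < ∞ := by
  set F : ℝ → ℝ≥0∞ := fun y => EReal.exp (overlapSum μ r x y : EReal) with hF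
  have hcod := hX.coding_address hg hx
  calc _ ≤ ∑' k : ℕ+, EReal.exp (C : EReal) * ∫⁻ y in annulus g X k x, F y ∂ν := by
        refine ENNReal.tsum_le_tsum fun k => ?_
        rw [mul_comm, ← setLIntegral_const, ← lintegral_const_mul' _ _ (exp_coe_lt_top hC).ne]
        refine setLIntegral_mono' (hX.measurableSet_annulus hg k x) fun y hy => ?_
        have h1 := hle (address g x) k y k.pos (by
          rw [hcod]; exact hX.dist_le_of_mem_annulus hg hx hy)
        rw [hcod, add_comm] at h1
        rw [hF, ← exp_coe_add]
        exact exp_coe_mono h1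
    _ = EReal.exp (C : EReal) * ∫⁻ y in ⋃ k : ℕ+, annulus g X k x, F y ∂ν := by
        rw [ENNReal.tsum_mul_left, lintegral_iUnion
          (fun k : ℕ+ => hX.measurableSet_annulus hg k x) (hX.pairwise_disjoint_annulus x)]
    _ ≤ EReal.exp (C : EReal) * ∫⁻ y, F y ∂ν := by
        gcongr
        exact Measure.restrict_le_self
    _ < ∞ := ENNReal.mul_lt_top (exp_coe_lt_top hC) h

end Estimates

end DvoretzkyCovering

/-! ### The equivalence. -/

theorem proposition5p3 {Λ : Type*} [Fintype Λ] [Nontrivial Λ]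
    (g : Λ → ℝ → ℝ) (hg : IsSelfConformalIFS g)
    (X : Set ℝ) (hX : IsAttractor g X) (hsep : StrongSeparation g X)
    (δ : ℝ) (hδ : IsSeparationConstant g X δ)
    (s : ℝ) (μ : Measure ℝ) (hμ : IsConformalMeasure g X s μ)
    (r : ℕ → ℝ) (hr_pos : ∀ n, 1 ≤ n → 0 < r n) (hr_anti : AntitoneOn r (Ici 1))
    (hr_lim : Tendsto r atTop (𝓝 0))
    (hsums : BoundedCylinderSums g X δ μ r) (hprod : BoundedProducts g X s r) :
    0 < capacity μ r X ↔
      ∃ ν : Measure ℝ, IsProbabilityMeasure ν ∧ ν.support ⊆ X ∧ (∀ x, ν {x} = 0) ∧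
        ∀ᵐ x ∂ν,
          ∑' k : ℕ+, ν (annulus g X k x) *
            EReal.exp ((∑ n ∈ Finset.Icc 1 (upperIndex g X δ r (address g x) k),
              μ (Metric.ball x (r n)) : ℝ≥0∞) : EReal) < ∞ := by
  have := hμ.isProbabilityMeasure
  have hs := hμ.pressure_eq_zero.pos_of_zero hX hg hsep
  constructor
  · intro hcap
    -- A measure of finite energy can have atoms only where this sum converges. One point of
    -- convergence already makes `μ` itself admissible; if there is none, the finite-energy measure
    -- has no atoms.
    by_cases hfin : ∃ x ∈ X, ∑' n : ℕ+, μ (Metric.ball x (r n)) < ∞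
    · obtain ⟨x₀, hx₀, h⟩ := hfin
      obtain ⟨C, hC, hle⟩ :=
        exists_sum_le_of_tsum_lt_top hg hX hsep hδ hμ hr_pos hr_anti hr_lim hx₀ h
      exact ⟨μ, this, hμ.support_subset, hμ.measure_singleton hX hg hsep hδ hs,
        ae_of_all _ (annulus_sum_lt_top_of_sum_le hX hg hC hle)⟩
    · push Not at hfin
      simp only [capacity, lt_iSup_iff] at hcap
      obtain ⟨ν, hprob, hsupp, -, hν⟩ := hcap
      have hpot : ∀ᵐ x ∂ν, ∫⁻ y, EReal.exp (overlapSum μ r x y : EReal) ∂ν < ∞ :=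
        ae_lt_top (measurable_potential r) (ENNReal.inv_pos.1 hν)
      have hνX : ν Xᶜ = 0 :=
        measure_mono_null (compl_subset_compl.2 hsupp) Measure.measure_compl_support
      obtain ⟨C, hC, hle⟩ :=
        exists_sum_le_overlapSum hg hX hsep hδ hμ hr_anti hr_lim hsums hprod
      refine ⟨ν, hprob, hsupp, fun x => ?_, ?_⟩
      · by_cases hx : x ∈ X
        · exact measure_singleton_eq_zero_of_potential_lt_top (top_le_iff.1 (hfin x hx)) hpot
        · exact measure_mono_null (singleton_subset_iff.2 hx) hνX
      · have hXae : ∀ᵐ x ∂ν, x ∈ X := hνX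
        filter_upwards [hpot, hXae] with x hx hxX
        exact annulus_sum_lt_top_of_potential_lt_top hX hg hC hle hxX hx
  · rintro ⟨ν, hprob, hsupp, hatom, h⟩
    exact capacity_pos_of_annulus_sum_lt_top hg hX hsep hδ hμ hr_anti hr_lim hsums hprod hsupp
      hatom h
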